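/- **Theorem (asymptotic prediction regions by inverse regression).** Let $L\ge 1$ and $D\ge 0$ be integers, let $\Gamma\in\mathbb R^{L\times L}$ be symmetric positive definite, $\Sigma\in\mathbb R^{D\times D}$ diagonal with positive diagonal entries, and $A\in\mathbb R^{D\times L}$. Put $$\Gamma^\star=\Sigma+A\Gamma A^\top,\qquad \Sigma^\star=(\Gamma^{-1}+A^\top\Sigma^{-1}A)^{-1},\qquad A^\star=g(A),\qquad g(B)=(\Gamma^{-1}+B^\top\Sigma^{-1}B)^{-1}B^\top\Sigma^{-1}.$$ Let $(x_i,y_i)_{i\ge1}$ be i.i.d. random pairs in $\mathbb R^D\times\mathbb R^L$ with $x_i\sim\mathcal N_D(0,\Gamma^\star)$ and $y_i=A^\star x_i+\varepsilon_i$, where $\varepsilon_i\sim\mathcal N_L(0,\Sigma^\star)$ is independent of $x_i$. The matrices $\Gamma$ and $\Sigma$ are known. Let $X_N\in\mathbb R^{N\times D}$ and $Y_N\in\mathbb R^{N\times L}$ be the data matrices with rows $x_1^\top,\dots,x_N^\top$ and $y_1^\top,\dots,y_N^\top$, and let $$\widehat A=X_N^\top Y_N(Y_N^\top Y_N)^{-1}\in\mathbb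 R^{D\times L},\qquad \widehat A^\star=g(\widehat A)\in\mathbb R^{L\times D}.$$ With $Dg(A)$ the differential of $g$ at $A$ and $\operatorname{vec}$ the stacking of columns, let $$\Theta(A)=\operatorname{Cov}\bigl(\operatorname{vec}(Dg(A).(\widehat A-A))\bigr)$$ be the covariance matrix of this random vector (it depends on the sample size $N$, and exists for $N\ge L+2$), and for $x\in\mathbb R^D$ let $$\Omega(A^\star x)=(x^\top\otimes I_L)\,\Theta(A)\,(x\otimes I_L)\in\mathbb R^{L\times L}.$$ For $\alpha\in(0,1)$ let $\chi^2_L(1-\alpha)$ be the $(1-\alpha)$-quantile of the chi-squared distribution with $L$ degrees of freedom, and let $$\mathcal{PR}_{\alpha}(x)=\Bigl\{y\in\mathbb R^L:\ (y-\widehat A^\star x)^\top\bigl(\Omega(A^\star x)+\Sigma^\star\bigr)^{-1}(y-\widehat A^\star x)\le\chi^2_L(1-\alpha)\Bigr\}.$$ Then $$P\bigl(y_{N+1}\in\mathcal{PR}_{\alpha}(x_{N+1})\bigr)\longrightarrow 1-\alpha\qquad(N\to\infty),$$ and likewise for every fixed value $x\in\mathbb R^D$ of the new covariate: $$P\bigl(A^\star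 x+\varepsilon_{N+1}\in\mathcal{PR}_{\alpha}(x)\bigr)\longrightarrow 1-\alpha\qquad(N\to\infty).$$ -/

import Mathlib

open MeasureTheory ProbabilityTheory Filter Topology
open scoped Matrix Kronecker

noncomputable section

namespace InverseRegression

variable {L D : ℕ} {W : Type*} [MeasurableSpace W]

/-! ### Forward parameters as functions of the inverse parameters `(Gam, A, Sig)`

`Gam` is the covariance of the response, `A` the inverse slope matrix, and `Sig` the residual
covariance of the inverse regression `X = A Y + e`. -/

/-- `Gam⋆ = Sig + A Gam Aᵀ`. -/
def gamStar (Gam : Matrix (Fin L) (Fin L) ℝ) (A : Matrix (Fin D) (Fin L) ℝ)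
    (Sig : Matrix (Fin D) (Fin D) ℝ) : Matrix (Fin D) (Fin D) ℝ :=
  Sig + A * Gam * Aᵀ

/-- `Sig⋆ = (Gam⁻¹ + Aᵀ Sig⁻¹ A)⁻¹`. -/
def sigStar (Gam : Matrix (Fin L) (Fin L) ℝ) (A : Matrix (Fin D) (Fin L) ℝ)
    (Sig : Matrix (Fin D) (Fin D) ℝ) : Matrix (Fin L) (Fin L) ℝ :=
  (Gam⁻¹ + Aᵀ * Sig⁻¹ * A)⁻¹

/-- `A⋆ = g(A) = (Gam⁻¹ + Aᵀ Sig⁻¹ A)⁻¹ Aᵀ Sig⁻¹`. -/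
def aStar (Gam : Matrix (Fin L) (Fin L) ℝ) (Sig : Matrix (Fin D) (Fin D) ℝ)
    (A : Matrix (Fin D) (Fin L) ℝ) : Matrix (Fin L) (Fin D) ℝ :=
  (Gam⁻¹ + Aᵀ * Sig⁻¹ * A)⁻¹ * Aᵀ * Sig⁻¹

/-! ### The statistical model -/

/-- The pairs `(X i, Y i)` are i.i.d. and follow the Gaussian linear model `X i ∼ N(0, GamS)`,
`Y i = AS X i + ε i` with `ε i ∼ N(0, SigS)` independent of `X i`. -/
structure IsForwardModel (P : Measure W) (GamS : Matrix (Fin D) (Fin D) ℝ)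
    (AS : Matrix (Fin L) (Fin D) ℝ) (SigS : Matrix (Fin L) (Fin L) ℝ)
    (X : ℕ → W → Fin D → ℝ) (Y : ℕ → W → Fin L → ℝ) : Prop where
  measurable_X : ∀ i, Measurable (X i)
  measurable_Y : ∀ i, Measurable (Y i)
  indep : iIndepFun (fun i w => (X i w, Y i w)) P
  law_X : ∀ i, HasLaw (fun w => WithLp.toLp 2 (X i w)) (multivariateGaussian 0 GamS) P
  law_noise : ∀ i,
    HasLaw (fun w => WithLp.toLp 2 (Y i w - AS *ᵥ X i w)) (multivariateGaussian 0 SigS) P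
  indep_noise : ∀ i, IndepFun (X i) (fun w => Y i w - AS *ᵥ X i w) P

/-! ### Estimators

The observations used are those with index `0, …, N - 1`; the new pair has index `N`. -/

/-- The `N × k` data matrix, one observation per row. -/
def dataMatrix {k : ℕ} (N : ℕ) (Z : ℕ → W → Fin k → ℝ) (w : W) : Matrix (Fin N) (Fin k) ℝ :=
  Matrix.of fun i j => Z i w j

/-- The least squares estimator of the inverse slope matrix,
`Â = Xᵀ Y (Yᵀ Y)⁻¹`, of size `D × L` (data matrices have one observation per row). -/
def aHat (X : ℕ → W → Fin D → ℝ) (Y : ℕ → W → Fin L → ℝ) (N : ℕ) (w : W) :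
    Matrix (Fin D) (Fin L) ℝ :=
  (dataMatrix N X w)ᵀ * dataMatrix N Y w * ((dataMatrix N Y w)ᵀ * dataMatrix N Y w)⁻¹

/-- The estimator `Â⋆ = g(Â)` of the forward slope matrix (`Gam`, `Sig` known). -/
def aStarHat (Gam : Matrix (Fin L) (Fin L) ℝ) (Sig : Matrix (Fin D) (Fin D) ℝ)
    (X : ℕ → W → Fin D → ℝ) (Y : ℕ → W → Fin L → ℝ) (N : ℕ) (w : W) :
    Matrix (Fin L) (Fin D) ℝ :=
  aStar Gam Sig (aHat X Y N w)

/-- The random matrix `Dg(A) . (Â - A)`, where `Dg(A)` is the differential at `A` of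
`g = aStar Gam Sig`. -/
def linearizedError (Gam : Matrix (Fin L) (Fin L) ℝ) (A : Matrix (Fin D) (Fin L) ℝ)
    (Sig : Matrix (Fin D) (Fin D) ℝ) (X : ℕ → W → Fin D → ℝ) (Y : ℕ → W → Fin L → ℝ)
    (N : ℕ) (w : W) : Matrix (Fin L) (Fin D) ℝ :=
  fderiv ℝ (aStar Gam Sig) A (aHat X Y N w - A)

/-- `Θ(A) = Cov(vec(Dg(A) . (Â - A)))`, the covariance matrix of the random vector obtained by
stacking the columns of the `L × D` matrix `Dg(A) . (Â - A)`; here `Â` is computed from `N`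
observations. -/
def theta (P : Measure W) (Gam : Matrix (Fin L) (Fin L) ℝ) (A : Matrix (Fin D) (Fin L) ℝ)
    (Sig : Matrix (Fin D) (Fin D) ℝ) (X : ℕ → W → Fin D → ℝ) (Y : ℕ → W → Fin L → ℝ)
    (N : ℕ) : Matrix (Fin D × Fin L) (Fin D × Fin L) ℝ :=
  Matrix.of fun p q =>
    cov[fun w => (linearizedError Gam A Sig X Y N w).vec p,
      fun w => (linearizedError Gam A Sig X Y N w).vec q; P]

/-- The `L × DL` matrix `xᵀ ⊗ I_L`; it sends `vec M` to `M x`. -/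
def rowKron (L : ℕ) (x : Fin D → ℝ) : Matrix (Fin L) (Fin D × Fin L) ℝ :=
  (Matrix.replicateRow Unit x ⊗ₖ (1 : Matrix (Fin L) (Fin L) ℝ)).submatrix (fun l => ((), l)) id

/-- `rowKron` represents `vec M ↦ M x`. -/
theorem rowKron_mulVec_vec (x : Fin D → ℝ) (M : Matrix (Fin L) (Fin D) ℝ) :
    rowKron L x *ᵥ M.vec = M *ᵥ x := by
  ext l
  simp [rowKron, Matrix.mulVec, dotProduct, Fintype.sum_prod_type, Matrix.one_apply, mul_comm]

/-- `Ω(A⋆ x) = (xᵀ ⊗ I_L) Θ(A) (x ⊗ I_L)`. -/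
def omega (P : Measure W) (Gam : Matrix (Fin L) (Fin L) ℝ) (A : Matrix (Fin D) (Fin L) ℝ)
    (Sig : Matrix (Fin D) (Fin D) ℝ) (X : ℕ → W → Fin D → ℝ) (Y : ℕ → W → Fin L → ℝ)
    (N : ℕ) (x : Fin D → ℝ) : Matrix (Fin L) (Fin L) ℝ :=
  rowKron L x * theta P Gam A Sig X Y N * (rowKron L x)ᵀ

/-! ### Chi-squared quantiles -/

/-- The `χ²` distribution with `k` degrees of freedom: the law of the sum of the squares of `k`
independent standard normal variables. -/
def chiSq (k : ℕ) : Measure ℝ :=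
  (Measure.pi fun _ : Fin k => gaussianReal 0 1).map fun z => ∑ i, z i ^ 2

/-- The `p`-quantile of the `χ²` distribution with `k` degrees of freedom. -/
def chiSqQuantile (k : ℕ) (p : ℝ) : ℝ :=
  sInf {t : ℝ | p ≤ (chiSq k).real (Set.Iic t)}

/-! ### The prediction region -/

/-- The prediction region at the covariate `x`, computed from `N` observations: the set of
`y` with `(y - Â⋆ x)ᵀ (Ω(A⋆ x) + Sig⋆)⁻¹ (y - Â⋆ x) ≤ χ²_L(1 - α)`. -/
def predictionRegion (P : Measure W) (Gam : Matrix (Fin L) (Fin L) ℝ)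
    (A : Matrix (Fin D) (Fin L) ℝ) (Sig : Matrix (Fin D) (Fin D) ℝ)
    (X : ℕ → W → Fin D → ℝ) (Y : ℕ → W → Fin L → ℝ) (α : ℝ) (N : ℕ) (w : W)
    (x : Fin D → ℝ) : Set (Fin L → ℝ) :=
  {y | (y - aStarHat Gam Sig X Y N w *ᵥ x) ⬝ᵥ
      ((omega P Gam A Sig X Y N x + sigStar Gam A Sig)⁻¹ *ᵥ
        (y - aStarHat Gam Sig X Y N w *ᵥ x)) ≤ chiSqQuantile L (1 - α)}

end InverseRegression

end

/-! The prediction error at `x` is the new noise `ε` plus `(A⋆ - Â⋆) x`. The inverse parametrization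
gives `Cov(x, y) = A Γ` and `Var(y) = Γ`, so the strong law yields `Â → A` almost surely, and `Â⋆ →
A⋆` by continuity of `g`. Once `Ω → 0` is known, the quadratic form converges to `εᵀ Σ⋆⁻¹ ε`, which
is `χ²_L`-distributed; this law has no atoms, so the coverage converges to `1 - α`.

The real work is `Ω → 0`: almost sure convergence does not control covariances. Bounded fourth
moments of `Â` upgrade it to convergence in `L²`, hence `Θ → 0`, because `Dg(A)` is linear. Least
squares fitting is a projection, so a row `a` of `Â` satisfies `λ ‖a‖² ≤` the mean square of the
corresponding coordinate of `x`, with `λ` the smallest eigenvalue of `YᵀY / N`; negative moments of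
`λ` are therefore needed, uniformly in `N`.

To get them, cut the sample into `L × L` blocks. The squared smallest singular value of a block is
at least `minSq`, which has a finite moment of order `-1/8`: Laplace expansion bounds the moment of
order `-1/2` of the determinant (`lintegral_det_rpow_le`), and the adjugate has second moments. By
AM-GM and independence, the mean of more than 32 blocks has a moment of order `-4` bounded uniformly
in their number (`lintegral_mean_rpow_neg_le`), which gives `exists_lintegral_aHat_pow_le`.

The new pair changes with `N`, so `tendsto_coverage` replaces it by one fixed pair on a product
space, where almost sure convergence makes sense. -/

open scoped ENNReal NNReal

/-! ### Negative moments of Gaussian determinants -/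

/-- The negative moment of order `-s` of `c ⬝ᵥ y`, for `y ∼ ν`, is at most `K * |c j| ^ (-s)` for
every coordinate `j`: a quantitative form of non-concentration of `ν` near hyperplanes. -/
def HasNegMomentBound {k : ℕ} (s : ℝ) (K : ℝ≥0∞) (ν : Measure (Fin k → ℝ)) : Prop :=
  ∀ (c : Fin k → ℝ) (j : Fin k), ∫⁻ y, ‖c ⬝ᵥ y‖ₑ ^ (-s) ∂ν ≤ K * ‖c j‖ₑ ^ (-s)

theorem measurable_det_of {α : Type*} [MeasurableSpace α] {n : Type*} [Fintype n] [DecidableEq n]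
    {f : α → Matrix n n ℝ} (hf : ∀ i j, Measurable fun a => f a i j) :
    Measurable fun a => (f a).det := by
  simp only [Matrix.det_apply]
  fun_prop

/-- Pad `c` with a zero. The minors of the Laplace expansion below have rows with this truncated
law. -/
theorem HasNegMomentBound.map_tail {k : ℕ} {s : ℝ} {K : ℝ≥0∞} {ν : Measure (Fin (k + 1) → ℝ)}
    (h : HasNegMomentBound s K ν) : HasNegMomentBound s K (ν.map fun y i => y (Fin.succ i)) := by
  intro c j
  rw [lintegral_map (by unfold dotProduct; fun_prop) (by fun_prop)]
  have := h (Fin.cons 0 c) j.succ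
  simpa [dotProduct, Fin.sum_univ_succ] using this

/-- Laplace expansion along the first row, one row at a time. -/
theorem lintegral_det_rpow_le {s : ℝ} {K : ℝ≥0∞} (k : ℕ) (ν : Measure (Fin k → ℝ))
    [IsProbabilityMeasure ν] (h : HasNegMomentBound s K ν) :
    ∫⁻ M, ‖(Matrix.of M).det‖ₑ ^ (-s) ∂(Measure.pi fun _ : Fin k => ν) ≤ K ^ k := by
  induction k with
  | zero => simp
  | succ k ih =>
    have hmp := (measurePreserving_piFinSuccAbove (fun _ : Fin (k + 1) => ν) 0).symm
    have hmeas : Measurable fun M : Fin (k + 1) → Fin (k + 1) → ℝ =>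
        ‖(Matrix.of M).det‖ₑ ^ (-s) :=
      ((measurable_det_of (f := fun M => Matrix.of M)
        (fun i j => by simp only [Matrix.of_apply]; fun_prop)).enorm).pow_const _
    rw [← hmp.lintegral_comp hmeas]
    refine (lintegral_prod_symm _ (hmeas.comp hmp.measurable).aemeasurable).trans_le ?_
    have htail : Measurable fun (y : Fin (k + 1) → ℝ) (i : Fin k) => y i.succ := by fun_prop
    have hmap : Measure.map (fun (M : Fin k → Fin (k + 1) → ℝ) i j => M i (Fin.succ j))
        (Measure.pi fun _ : Fin k => ν)
        = Measure.pi fun _ : Fin k => ν.map fun y i => y (Fin.succ i) :=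
      Measure.pi_map_pi (f := fun _ (y : Fin (k + 1) → ℝ) i => y (Fin.succ i))
        fun _ => htail.aemeasurable
    have hprob : IsProbabilityMeasure (ν.map fun y (i : Fin k) => y (Fin.succ i)) :=
      Measure.isProbabilityMeasure_map htail.aemeasurable
    have hmeas' : Measurable fun M : Fin k → Fin k → ℝ => ‖(Matrix.of M).det‖ₑ ^ (-s) :=
      ((measurable_det_of (f := fun M => Matrix.of M)
        (fun i j => by simp only [Matrix.of_apply]; fun_prop)).enorm).pow_const _
    calc _ ≤ ∫⁻ M : Fin k → Fin (k + 1) → ℝ,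
          K * ‖(Matrix.of fun i j => M i (Fin.succ j)).det‖ₑ ^ (-s)
          ∂(Measure.pi fun _ : Fin k => ν) := by
          refine lintegral_mono fun M => ?_
          -- The coefficients are the cofactors of the first row, which depend only on the other
          -- rows `M`. Taking coordinate `0` leaves the minor without the first column, ready for
          -- induction.
          have := h (fun j => (-1) ^ (j : ℕ) *
            (Matrix.of fun i l => M i (j.succAbove l)).det) 0
          simp only [Fin.coe_ofNat_eq_mod, Nat.zero_mod, pow_zero, one_mul,
            Fin.succAbove_zero] at this
          refine le_trans (le_of_eq ?_) this
          refine lintegral_congr fun y => ?_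
          rw [Function.comp_apply, Matrix.det_succ_row_zero]
          congr 2
          refine Finset.sum_congr rfl fun j _ => ?_
          have e : (Matrix.of ((MeasurableEquiv.piFinSuccAbove (fun _ => Fin (k + 1) → ℝ) 0).symm
              (y, M))).submatrix Fin.succ j.succAbove
              = Matrix.of fun i l => M i (j.succAbove l) := by
            ext i l
            simp [MeasurableEquiv.piFinSuccAbove, Fin.insertNthEquiv]
          rw [e]
          simp [MeasurableEquiv.piFinSuccAbove, Fin.insertNthEquiv]
          ring
      _ = K * ∫⁻ M, ‖(Matrix.of M).det‖ₑ ^ (-s)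
          ∂(Measure.pi fun _ : Fin k => ν.map fun y (i : Fin k) => y (Fin.succ i)) := by
          rw [← hmap, lintegral_map hmeas' (by fun_prop), lintegral_const_mul]
          · exact hmeas'.comp (g := fun M : Fin k → Fin k → ℝ => ‖(Matrix.of M).det‖ₑ ^ (-s))
              (f := fun (M : Fin k → Fin (k + 1) → ℝ) i j => M i (Fin.succ j)) (by fun_prop)
      _ ≤ K * K ^ k := by
          gcongr
          exact ih _ h.map_tail
      _ = K ^ (k + 1) := (pow_succ' K k).symm

theorem gaussianReal_zero_one_le_volume : gaussianReal 0 1 ≤ (volume : Measure ℝ) := by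
  rw [gaussianReal_of_var_ne_zero 0 one_ne_zero]
  refine (withDensity_mono (g := 1) (ae_of_all _ fun u => ?_)).trans (by simp)
  rw [gaussianPDF, gaussianPDFReal, Pi.one_apply, ENNReal.ofReal_le_one]
  have h1 : (√(2 * Real.pi * ((1 : ℝ≥0) : ℝ)))⁻¹ ≤ 1 := by
    apply inv_le_one_of_one_le₀
    rw [Real.one_le_sqrt]
    have := Real.pi_gt_three
    simp only [NNReal.coe_one]
    linarith
  have h2 : Real.exp (-(u - 0) ^ 2 / (2 * ((1 : ℝ≥0) : ℝ))) ≤ 1 := by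
    rw [Real.exp_le_one_iff]
    simp only [NNReal.coe_one]
    nlinarith [sq_nonneg (u - 0)]
  exact mul_le_one₀ h1 (Real.exp_pos _).le h2

theorem integrableOn_abs_rpow {r : ℝ} (hr : -1 < r) :
    IntegrableOn (fun u : ℝ => |u| ^ r) (Set.Icc (-1) 1) := by
  have h1 : IntervalIntegrable (fun u : ℝ => |u| ^ r) volume 0 1 := by
    refine (intervalIntegral.intervalIntegrable_rpow' (a := 0) (b := 1) hr).congr fun u hu => ?_
    rw [Set.uIoc_of_le zero_le_one] at hu
    simp only [abs_of_pos hu.1]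
  have h2 : IntervalIntegrable (fun u : ℝ => |u| ^ r) volume (-1) 0 := by
    rw [IntervalIntegrable.iff_comp_neg]
    simpa using h1.symm
  rw [← intervalIntegrable_iff_integrableOn_Icc_of_le (by norm_num)]
  exact h2.trans h1

/-- Outside `[-1, 1]` the integrand is at most `1`; inside, the normal law is dominated by Lebesgue
measure and `|u| ^ (-s)` is integrable because `s < 1`. -/
theorem lintegral_rpow_gaussianReal_lt_top {s : ℝ} (hs0 : 0 < s) (hs1 : s < 1) :
    ∫⁻ u, ‖u‖ₑ ^ (-s) ∂(gaussianReal 0 1) < ∞ := by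
  have hsplit : ∀ u : ℝ, ‖u‖ₑ ^ (-s) ≤ 1 + (Set.Icc (-1) 1).indicator (fun u => ‖u‖ₑ ^ (-s)) u := by
    intro u
    by_cases hu : u ∈ Set.Icc (-1 : ℝ) 1
    · simp [hu]
    · rw [Set.indicator_of_notMem hu, add_zero]
      refine ENNReal.rpow_le_one_of_one_le_of_neg ?_ (by linarith)
      rw [Real.enorm_eq_ofReal_abs, ENNReal.one_le_ofReal]
      rw [Set.mem_Icc, ← abs_le] at hu
      exact (not_le.1 hu).le
  calc _ ≤ ∫⁻ u, 1 + (Set.Icc (-1) 1).indicator (fun u => ‖u‖ₑ ^ (-s)) u ∂(gaussianReal 0 1) :=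
        lintegral_mono hsplit
    _ = 1 + ∫⁻ u, (Set.Icc (-1) 1).indicator (fun u => ‖u‖ₑ ^ (-s)) u ∂(gaussianReal 0 1) := by
        rw [lintegral_add_left measurable_const]; simp
    _ ≤ 1 + ∫⁻ u : ℝ in Set.Icc (-1) 1, ‖u‖ₑ ^ (-s) := by
        rw [← lintegral_indicator measurableSet_Icc]
        exact add_le_add le_rfl (lintegral_mono' gaussianReal_zero_one_le_volume le_rfl)
    _ < ∞ := by
        refine ENNReal.add_lt_top.2 ⟨ENNReal.one_lt_top, ?_⟩
        have h := (integrableOn_abs_rpow (r := -s) (by linarith)).hasFiniteIntegral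
        refine lt_of_eq_of_lt (lintegral_congr_ae ?_) h
        have h0 : ∀ᵐ u : ℝ ∂(volume.restrict (Set.Icc (-1) 1)), u ≠ 0 :=
          ae_restrict_of_ae (by simp [ae_iff])
        filter_upwards [h0] with u hu
        rw [Real.enorm_eq_ofReal_abs, Real.enorm_of_nonneg (by positivity),
          ENNReal.ofReal_rpow_of_pos (abs_pos.2 hu)]

theorem lintegral_rpow_gaussianReal (s : ℝ) (v : ℝ≥0) :
    ∫⁻ u, ‖u‖ₑ ^ (-s) ∂(gaussianReal 0 v)
      = ‖√(v : ℝ)‖ₑ ^ (-s) * ∫⁻ u, ‖u‖ₑ ^ (-s) ∂(gaussianReal 0 1) := by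
  have : gaussianReal 0 v = (gaussianReal 0 1).map fun x => √(v : ℝ) * x := by
    rw [gaussianReal_map_const_mul]
    congr 1
    · simp
    · ext; simp
  rw [this, lintegral_map (by fun_prop) (by fun_prop), ← lintegral_const_mul _ (by fun_prop)]
  refine lintegral_congr fun u => ?_
  rw [enorm_mul, ENNReal.mul_rpow_of_ne_top (by simp) (by simp)]

/-- Cauchy-Schwarz for a positive definite quadratic form. -/
theorem sq_le_inv_mul_dotProduct_mulVec {k : ℕ} {G : Matrix (Fin k) (Fin k) ℝ} (hG : G.PosDef)
    (c : Fin k → ℝ) (j : Fin k) : c j ^ 2 ≤ G⁻¹ j j * (c ⬝ᵥ G *ᵥ c) := by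
  set e : Fin k → ℝ := Pi.single j 1
  have hsymm : Gᵀ = G := by simpa using hG.1.eq
  have hdet : IsUnit G.det := hG.det_pos.ne'.isUnit
  have hGe : G *ᵥ (G⁻¹ *ᵥ e) = e := by
    rw [Matrix.mulVec_mulVec, Matrix.mul_nonsing_inv _ hdet, Matrix.one_mulVec]
  -- Positivity of the form at `c - t G⁻¹ eⱼ` is a quadratic inequality in `t`; its discriminant is
  -- the claim.
  have key : ∀ t : ℝ, 0 ≤ G⁻¹ j j * (t * t) + (-(2 * c j)) * t + c ⬝ᵥ G *ᵥ c := by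
    intro t
    have h := hG.posSemidef.dotProduct_mulVec_nonneg (c - t • (G⁻¹ *ᵥ e))
    have h1 : c ⬝ᵥ e = c j := by simp [e]
    have h2 : (G⁻¹ *ᵥ e) ⬝ᵥ G *ᵥ c = c j := by
      rw [Matrix.dotProduct_mulVec, ← Matrix.mulVec_transpose, hsymm, hGe, dotProduct_comm, h1]
    have h3 : (G⁻¹ *ᵥ e) ⬝ᵥ e = G⁻¹ j j := by simp [e]
    simp only [star_trivial, Matrix.mulVec_sub, Matrix.mulVec_smul, hGe, sub_dotProduct,
      dotProduct_sub, smul_dotProduct, dotProduct_smul, smul_eq_mul, h1, h2, h3] at h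
    linarith
  have := discrim_le_zero key
  rw [discrim] at this
  linarith

/-- The variable `c ⬝ᵥ y` is centred normal with variance `cᵀ G c ≥ (c j)² / (G⁻¹) j j`, so scaling
reduces to the standard normal law. -/
theorem hasNegMomentBound_multivariateGaussian {k : ℕ} {G : Matrix (Fin k) (Fin k) ℝ}
    (hG : G.PosDef) {s : ℝ} (hs0 : 0 < s) (hs1 : s < 1) :
    ∃ K : ℝ≥0∞, K ≠ ∞ ∧
      HasNegMomentBound s K ((multivariateGaussian 0 G).map (WithLp.ofLp : _ → Fin k → ℝ)) := by
  obtain ⟨m, hm0, hm⟩ : ∃ m : ℝ, 0 < m ∧ ∀ j, G⁻¹ j j ≤ m ^ 2 := by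
    refine ⟨1 + ∑ j, G⁻¹ j j, ?_, fun j => ?_⟩
    all_goals
      have h0 : 0 ≤ ∑ j, G⁻¹ j j := Finset.sum_nonneg fun j _ => hG.inv.posSemidef.diag_nonneg
    · linarith
    · have := Finset.single_le_sum (f := fun j => G⁻¹ j j)
        (fun j _ => hG.inv.posSemidef.diag_nonneg) (Finset.mem_univ j)
      have h2 : G⁻¹ j j ≤ ∑ j, G⁻¹ j j := this
      nlinarith
  have hI := lintegral_rpow_gaussianReal_lt_top hs0 hs1
  set I := ∫⁻ u, ‖u‖ₑ ^ (-s) ∂(gaussianReal 0 1) with hIdef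
  -- Adding `1` to `I` makes the constant visibly nonzero, so that the bound is `∞` when `c j = 0`.
  refine ⟨ENNReal.ofReal m ^ s * (I + 1), ?_, fun c j => ?_⟩
  · exact ENNReal.mul_ne_top (ENNReal.rpow_ne_top_of_nonneg hs0.le (by simp))
      (by simp [hI.ne])
  rcases eq_or_ne (c j) 0 with hc | hc
  · have : (ENNReal.ofReal m) ^ s * (I + 1) ≠ 0 := by
      refine mul_ne_zero ?_ (by simp)
      exact (ENNReal.rpow_pos (by simpa using hm0) (by simp)).ne'
    simp [hc, ENNReal.zero_rpow_of_neg, hs0, ENNReal.mul_top this]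
  have hlaw : (multivariateGaussian 0 G).map
      (fun y : EuclideanSpace ℝ (Fin k) => c ⬝ᵥ WithLp.ofLp y)
      = gaussianReal 0 (c ⬝ᵥ G *ᵥ c).toNNReal := by
    set ℓ : StrongDual ℝ (EuclideanSpace ℝ (Fin k)) := innerSL ℝ (WithLp.toLp 2 c) with hℓ
    have hfun : (fun y : EuclideanSpace ℝ (Fin k) => c ⬝ᵥ WithLp.ofLp y) = ℓ := by
      ext y
      simp [hℓ, PiLp.inner_apply, dotProduct, mul_comm]
    rw [hfun, IsGaussian.map_eq_gaussianReal,
      ℓ.integral_comp_id_comm IsGaussian.integrable_id]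
    have hv : Var[ℓ; multivariateGaussian 0 G] = c ⬝ᵥ G *ᵥ c := by
      rw [← covariance_self (by fun_prop)]
      have := covarianceBilin_multivariateGaussian (μ := 0) hG.posSemidef
        (WithLp.toLp 2 c) (WithLp.toLp 2 c)
      rw [covarianceBilin_apply_eq_cov IsGaussian.memLp_two_id] at this
      exact this
    rw [hv]
    simp
  have hpos : 0 < c ⬝ᵥ G *ᵥ c := by
    have : c ≠ 0 := fun h => hc (by simp [h])
    simpa using hG.dotProduct_mulVec_pos this
  have hbd : |c j| / m ≤ √(c ⬝ᵥ G *ᵥ c) := by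
    apply Real.le_sqrt_of_sq_le
    rw [div_pow, sq_abs, div_le_iff₀ (by positivity)]
    nlinarith [sq_le_inv_mul_dotProduct_mulVec hG c j, hm j]
  rw [lintegral_map (by unfold dotProduct; fun_prop) (by fun_prop)]
  have e1 : ∫⁻ y, ‖c ⬝ᵥ WithLp.ofLp y‖ₑ ^ (-s) ∂(multivariateGaussian 0 G)
      = ∫⁻ u, ‖u‖ₑ ^ (-s) ∂(gaussianReal 0 (c ⬝ᵥ G *ᵥ c).toNNReal) := by
    rw [← hlaw, lintegral_map (by fun_prop) (by unfold dotProduct; fun_prop)]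
  rw [e1, lintegral_rpow_gaussianReal, ← hIdef, Real.coe_toNNReal _ hpos.le]
  have e2 : ‖√(c ⬝ᵥ G *ᵥ c)‖ₑ ^ (-s) ≤ ENNReal.ofReal m ^ s * ‖c j‖ₑ ^ (-s) := by
    rw [Real.enorm_eq_ofReal_abs (c j), Real.enorm_of_nonneg (Real.sqrt_nonneg _),
      ENNReal.ofReal_rpow_of_pos (Real.sqrt_pos.2 hpos), ENNReal.ofReal_rpow_of_pos hm0,
      ENNReal.ofReal_rpow_of_pos (abs_pos.2 hc), ← ENNReal.ofReal_mul (by positivity)]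
    apply ENNReal.ofReal_le_ofReal
    have h := Real.rpow_le_rpow_of_nonpos (div_pos (abs_pos.2 hc) hm0) hbd
      (by linarith : -s ≤ 0)
    rw [Real.div_rpow (abs_nonneg _) hm0.le, Real.rpow_neg hm0.le, div_inv_eq_mul] at h
    linarith
  calc _ ≤ ENNReal.ofReal m ^ s * ‖c j‖ₑ ^ (-s) * (I + 1) := by gcongr; exact le_self_add
    _ = _ := by ring

/-! ### A lower bound for the smallest singular value -/

/-- `det M ^ 2` divided by one plus the squared Frobenius norm of the adjugate: a lower bound for
the square of the smallest singular value of `M`. -/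
noncomputable def minSq {k : ℕ} (M : Matrix (Fin k) (Fin k) ℝ) : ℝ≥0 :=
  (M.det ^ 2 / (1 + ∑ i, ∑ j, M.adjugate i j ^ 2)).toNNReal

theorem coe_minSq {k : ℕ} (M : Matrix (Fin k) (Fin k) ℝ) :
    (minSq M : ℝ) = M.det ^ 2 / (1 + ∑ i, ∑ j, M.adjugate i j ^ 2) :=
  Real.coe_toNNReal _ (by positivity)

/-- Since `det M • u = adj M (M u)`, apply Cauchy-Schwarz to each row of the adjugate. -/
theorem minSq_mul_le {k : ℕ} (M : Matrix (Fin k) (Fin k) ℝ) (u : Fin k → ℝ) :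
    (minSq M : ℝ) * (u ⬝ᵥ u) ≤ (M *ᵥ u) ⬝ᵥ (M *ᵥ u) := by
  have hq : 0 ≤ ∑ i, ∑ j, M.adjugate i j ^ 2 := by positivity
  have hv : 0 ≤ (M *ᵥ u) ⬝ᵥ (M *ᵥ u) := by
    simp only [dotProduct, ← sq]
    positivity
  rw [coe_minSq, div_mul_eq_mul_div, div_le_iff₀ (by positivity)]
  have h : M.det • u = M.adjugate *ᵥ (M *ᵥ u) := by
    rw [Matrix.mulVec_mulVec, Matrix.adjugate_mul, Matrix.smul_mulVec, Matrix.one_mulVec]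
  calc M.det ^ 2 * (u ⬝ᵥ u) = ∑ i, (M.det • u) i ^ 2 := by
        simp only [dotProduct, Finset.mul_sum, Pi.smul_apply, smul_eq_mul]
        exact Finset.sum_congr rfl fun i _ => by ring
    _ ≤ ∑ i, (∑ j, M.adjugate i j ^ 2) * ((M *ᵥ u) ⬝ᵥ (M *ᵥ u)) := by
        refine Finset.sum_le_sum fun i _ => ?_
        rw [h]
        simpa [Matrix.mulVec, dotProduct, sq] using
          Finset.sum_mul_sq_le_sq_mul_sq Finset.univ (M.adjugate i) (M *ᵥ u)
    _ ≤ _ := by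
        rw [← Finset.sum_mul]
        nlinarith

/-- With `d = |det M|` and `q` the denominator, `(d² / q) ^ (-1/8) = d ^ (-1/4) q ^ (1/8) ≤ d ^
(-1/2) + q ^ (1/4)`, and `q ≥ 1`. The sum lets determinant and adjugate be integrated separately. -/
theorem minSq_rpow_le {k : ℕ} (M : Matrix (Fin k) (Fin k) ℝ) :
    (minSq M : ℝ≥0∞) ^ (-(1 / 8) : ℝ) ≤
      ‖M.det‖ₑ ^ (-(1 / 2) : ℝ) + ENNReal.ofReal (1 + ∑ i, ∑ j, M.adjugate i j ^ 2) := by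
  set q := 1 + ∑ i, ∑ j, M.adjugate i j ^ 2 with hq
  have hq1 : 1 ≤ q := by
    have : 0 ≤ ∑ i, ∑ j, M.adjugate i j ^ 2 := by positivity
    linarith
  rcases eq_or_ne M.det 0 with h0 | h0
  · rw [h0, enorm_zero, ENNReal.zero_rpow_of_neg (by norm_num), top_add]
    exact le_top
  have hd : 0 < |M.det| := abs_pos.2 h0
  have hm : (minSq M : ℝ≥0∞) = ENNReal.ofReal (|M.det| ^ 2 / q) := by
    rw [sq_abs]; rfl
  rw [hm, Real.enorm_eq_ofReal_abs, ENNReal.ofReal_rpow_of_pos (by positivity),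
    ENNReal.ofReal_rpow_of_pos hd, ← ENNReal.ofReal_add (by positivity) (by positivity)]
  apply ENNReal.ofReal_le_ofReal
  set a := |M.det| ^ (-(1 / 4) : ℝ) with ha
  have ha2 : |M.det| ^ (-(1 / 2) : ℝ) = a ^ 2 := by
    rw [ha, ← Real.rpow_natCast, ← Real.rpow_mul hd.le]; norm_num
  have hb : (|M.det| ^ 2 / q) ^ (-(1 / 8) : ℝ) = a * q ^ (1 / 8 : ℝ) := by
    rw [Real.div_rpow (by positivity) (by positivity), Real.rpow_neg (y := 1 / 8) (x := q) (by positivity),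
      div_inv_eq_mul, ← Real.rpow_natCast, ← Real.rpow_mul hd.le, ha]
    norm_num
  have hc : (q ^ (1 / 8 : ℝ)) ^ 2 ≤ q := by
    rw [← Real.rpow_natCast, ← Real.rpow_mul (by positivity)]
    calc q ^ (1 / 8 * ((2 : ℕ) : ℝ)) ≤ q ^ (1 : ℝ) :=
          Real.rpow_le_rpow_of_exponent_le hq1 (by norm_num)
      _ = q := Real.rpow_one q
  rw [ha2, hb]
  nlinarith [sq_nonneg (a - q ^ (1 / 8 : ℝ)), sq_nonneg a, sq_nonneg (q ^ (1 / 8 : ℝ))]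

/-- Each Leibniz term is a product of `k` entries, all in `L^{2k}`; Hölder puts it in `L²`. -/
theorem memLp_two_det {Ω : Type*} [MeasurableSpace Ω] {μ : Measure Ω} [IsProbabilityMeasure μ]
    {k : ℕ} {f : Ω → Matrix (Fin k) (Fin k) ℝ}
    (hf : ∀ i j, ∀ p : ℝ≥0∞, p ≠ ∞ → MemLp (fun a => f a i j) p μ) :
    MemLp (fun a => (f a).det) 2 μ := by
  simp only [Matrix.det_apply']
  refine memLp_finsetSum _ fun σ _ => MemLp.const_mul ?_ _
  rcases Nat.eq_zero_or_pos k with rfl | hk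
  · simpa using memLp_const 1
  · have h := MemLp.prod' (s := Finset.univ) (p := fun _ : Fin k => ((2 * k : ℕ) : ℝ≥0∞))
      fun i _ => hf (σ i) i _ (ENNReal.natCast_ne_top _)
    convert h using 1
    have hk' : (k : ℝ≥0∞) ≠ 0 := by exact_mod_cast hk.ne'
    simp only [Finset.sum_const, Finset.card_univ, Fintype.card_fin, nsmul_eq_mul, Nat.cast_mul,
      Nat.cast_ofNat]
    rw [ENNReal.mul_inv (a := 2) (Or.inl (by simp)) (Or.inl (by simp)), mul_left_comm,
      ENNReal.mul_inv_cancel hk' (by simp), mul_one, inv_inv]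

theorem memLp_two_adjugate {Ω : Type*} [MeasurableSpace Ω] {μ : Measure Ω} [IsProbabilityMeasure μ]
    {k : ℕ} {f : Ω → Matrix (Fin k) (Fin k) ℝ}
    (hf : ∀ i j, ∀ p : ℝ≥0∞, p ≠ ∞ → MemLp (fun a => f a i j) p μ) (i j : Fin k) :
    MemLp (fun a => (f a).adjugate i j) 2 μ := by
  simp only [Matrix.adjugate_apply]
  refine memLp_two_det fun i' j' p hp => ?_
  by_cases h : i' = j
  · subst h
    simpa using memLp_const _
  · simpa [Matrix.updateRow_ne h] using hf i' j' p hp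

theorem measurable_minSq {α : Type*} [MeasurableSpace α] {k : ℕ}
    {f : α → Matrix (Fin k) (Fin k) ℝ} (hf : ∀ i j, Measurable fun a => f a i j) :
    Measurable fun a => minSq (f a) := by
  have h1 := measurable_det_of hf
  have h2 : ∀ i j, Measurable fun a => (f a).adjugate i j := by
    intro i j
    simp only [Matrix.adjugate_apply]
    refine measurable_det_of fun i' j' => ?_
    by_cases h : i' = j
    · subst h; simp
    · simpa [Matrix.updateRow_ne h] using hf i' j'
  unfold minSq
  fun_prop

theorem lintegral_minSq_rpow_ne_top {k : ℕ} {ν : Measure (Fin k → ℝ)} [IsProbabilityMeasure ν]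
    {K : ℝ≥0∞} (hK : K ≠ ∞) (hν : HasNegMomentBound (1 / 2) K ν)
    (hmom : ∀ j, ∀ p : ℝ≥0∞, p ≠ ∞ → MemLp (fun y => y j) p ν) :
    ∫⁻ M, (minSq (Matrix.of M) : ℝ≥0∞) ^ (-(1 / 8) : ℝ) ∂(Measure.pi fun _ : Fin k => ν) ≠ ∞ := by
  set μ := Measure.pi fun _ : Fin k => ν
  have hentry : ∀ i j, ∀ p : ℝ≥0∞, p ≠ ∞ →
      MemLp (fun M : Fin k → Fin k → ℝ => Matrix.of M i j) p μ := fun i j p hp =>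
    (hmom j p hp).comp_measurePreserving (measurePreserving_eval (fun _ : Fin k => ν) i)
  have hint : Integrable (fun M : Fin k → Fin k → ℝ =>
      1 + ∑ i, ∑ j, (Matrix.of M).adjugate i j ^ 2) μ :=
    (integrable_const _).add (integrable_finsetSum _ fun i _ => integrable_finsetSum _ fun j _ =>
      (memLp_two_adjugate (f := fun M : Fin k → Fin k → ℝ => Matrix.of M) hentry i j).integrable_sq)
  refine ((lintegral_mono fun M => minSq_rpow_le (Matrix.of M)).trans_lt ?_).ne
  rw [lintegral_add_right' _ hint.aestronglyMeasurable.aemeasurable.ennreal_ofReal]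
  refine ENNReal.add_lt_top.2 ⟨?_, ?_⟩
  · exact (lintegral_det_rpow_le k ν hν).trans_lt (ENNReal.pow_lt_top hK.lt_top)
  · exact hint.lintegral_lt_top

/-! ### Negative moments of averages of independent variables -/

/-- AM-GM, reversed by the negative exponent. Independence can factor the product on the right. -/
theorem ennreal_arith_mean_rpow_neg_le {ι : Type*} {s : Finset ι} (hs : s.Nonempty) (z : ι → ℝ≥0)
    {p : ℝ} (hp : 0 ≤ p) :
    ((∑ i ∈ s, (z i : ℝ≥0∞)) / s.card) ^ (-p) ≤ ∏ i ∈ s, (z i : ℝ≥0∞) ^ (-(p / s.card)) := by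
  have hc : (0 : ℝ) < s.card := by exact_mod_cast hs.card_pos
  have h := NNReal.geom_mean_le_arith_mean_weighted s (fun _ => (s.card : ℝ≥0)⁻¹) z
    (by
      rw [Finset.sum_const, nsmul_eq_mul]
      exact mul_inv_cancel₀ (by exact_mod_cast hs.card_pos.ne'))
  have h' : ∏ i ∈ s, (z i : ℝ≥0∞) ^ (s.card : ℝ)⁻¹ ≤ (∑ i ∈ s, (z i : ℝ≥0∞)) / s.card := by
    rw [← Finset.mul_sum] at h
    have h2 := ENNReal.coe_le_coe.2 h
    rw [ENNReal.coe_mul, ENNReal.coe_inv (by exact_mod_cast hs.card_pos.ne'), mul_comm,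
      ← div_eq_mul_inv] at h2
    refine le_trans (le_of_eq ?_) (h2.trans (le_of_eq ?_))
    · push_cast
      refine Finset.prod_congr rfl fun i _ => ?_
      rw [ENNReal.coe_rpow_of_nonneg _ (by positivity)]
    · push_cast; rfl
  have h3 : ((∑ i ∈ s, (z i : ℝ≥0∞)) / s.card) ^ (-p) ≤
      (∏ i ∈ s, (z i : ℝ≥0∞) ^ (s.card : ℝ)⁻¹) ^ (-p) := by
    rw [ENNReal.rpow_neg, ENNReal.rpow_neg]
    exact ENNReal.inv_le_inv.2 (ENNReal.rpow_le_rpow h' hp)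
  refine h3.trans (le_of_eq ?_)
  rw [← ENNReal.prod_rpow_of_ne_top fun i _ => ENNReal.rpow_ne_top_of_nonneg (by positivity)
    ENNReal.coe_ne_top]
  refine Finset.prod_congr rfl fun i _ => ?_
  rw [← ENNReal.rpow_mul]
  congr 1
  field_simp

/-- Hölder against the constant `1`, with exponent `1 / t`. -/
theorem lintegral_rpow_le_rpow_lintegral {Ω : Type*} [MeasurableSpace Ω] {μ : Measure Ω}
    [IsProbabilityMeasure μ] {f : Ω → ℝ≥0∞} (hf : AEMeasurable f μ) {t : ℝ} (ht0 : 0 < t)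
    (ht1 : t < 1) : ∫⁻ a, f a ^ t ∂μ ≤ (∫⁻ a, f a ∂μ) ^ t := by
  have hconj := Real.HolderConjugate.conjExponent ((one_lt_inv₀ ht0).2 ht1)
  have h := ENNReal.lintegral_mul_le_Lp_mul_Lq μ hconj (hf.pow_const t)
    (aemeasurable_const (b := (1 : ℝ≥0∞)))
  simpa [← ENNReal.rpow_mul, ht0.ne'] using h

/-- Averaging improves negative moments: after AM-GM each factor carries only the exponent `p / B <
δ`, so a moment of order `-δ` suffices. The bound does not depend on `B`. -/
theorem lintegral_mean_rpow_neg_le {Ω : Type*} [MeasurableSpace Ω] {μ : Measure Ω}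
    [IsProbabilityMeasure μ] {Z : ℕ → Ω → ℝ≥0} (hZ : ∀ b, Measurable (Z b)) (hind : iIndepFun Z μ)
    {δ p : ℝ} (hδ : 0 < δ) (hp : 0 < p) {C : ℝ≥0∞}
    (hC : ∀ b, ∫⁻ w, (Z b w : ℝ≥0∞) ^ (-δ) ∂μ ≤ C) {B : ℕ} (hB : p / δ < B) :
    ∫⁻ w, ((∑ b ∈ Finset.range B, (Z b w : ℝ≥0∞)) / B) ^ (-p) ∂μ ≤ C ^ (p / δ) := by
  have hB0 : (0 : ℝ) < B := (by positivity : 0 < p / δ).trans hB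
  have hB0' : 0 < B := by exact_mod_cast hB0
  have hne : (Finset.range B).Nonempty := Finset.nonempty_range_iff.2 hB0'.ne'
  set t := p / δ / B with ht
  have ht0 : 0 < t := by positivity
  have ht1 : t < 1 := (div_lt_one hB0).2 hB
  calc ∫⁻ w, ((∑ b ∈ Finset.range B, (Z b w : ℝ≥0∞)) / B) ^ (-p) ∂μ
      ≤ ∫⁻ w, ∏ b ∈ Finset.range B, (Z b w : ℝ≥0∞) ^ (-(p / B)) ∂μ := by
        refine lintegral_mono fun w => ?_
        simpa using ennreal_arith_mean_rpow_neg_le hne (fun b => Z b w) hp.le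
    _ = ∏ b ∈ Finset.range B, ∫⁻ w, (Z b w : ℝ≥0∞) ^ (-(p / B)) ∂μ :=
        lintegral_prod_eq_prod_lintegral_of_indepFun _
          (fun b w => (Z b w : ℝ≥0∞) ^ (-(p / B)))
          (hind.comp (fun _ (z : ℝ≥0) => (z : ℝ≥0∞) ^ (-(p / B))) fun _ => by fun_prop)
          fun b => by have := hZ b; fun_prop
    _ ≤ ∏ _b ∈ Finset.range B, C ^ t := by
        refine Finset.prod_le_prod' fun b _ => ?_
        have e : ∀ w, (Z b w : ℝ≥0∞) ^ (-(p / B)) = ((Z b w : ℝ≥0∞) ^ (-δ)) ^ t := by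
          intro w
          rw [← ENNReal.rpow_mul]
          congr 1
          rw [ht]; field_simp
        simp_rw [e]
        have hm : AEMeasurable (fun w => (Z b w : ℝ≥0∞) ^ (-δ)) μ := by
          have := hZ b
          fun_prop
        exact (lintegral_rpow_le_rpow_lintegral hm ht0 ht1).trans
          (ENNReal.rpow_le_rpow (hC b) ht0.le)
    _ = C ^ (p / δ) := by
        rw [Finset.prod_const, Finset.card_range, ← ENNReal.rpow_natCast, ← ENNReal.rpow_mul, ht]
        congr 1
        field_simp

/-- Independence means that the joint law is a product; reindexing by the injective map `(b, i) ↦ b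
* k + i` and currying the product measure groups the factors into blocks. -/
theorem iIndepFun_block {Ω E : Type*} [MeasurableSpace Ω] [MeasurableSpace E] {μ : Measure Ω}
    {f : ℕ → Ω → E} (hf : ∀ i, Measurable (f i)) (hind : iIndepFun f μ) (k : ℕ) :
    iIndepFun (fun (b : ℕ) w (i : Fin k) => f (b * k + i) w) μ := by
  have := hind.isProbabilityMeasure
  have hinj : Function.Injective fun p : (_ : ℕ) × Fin k => p.1 * k + (p.2 : ℕ) := by
    rintro ⟨a, i⟩ ⟨b, j⟩ h
    have hk : 0 < k := i.pos
    have h1 : a = b := by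
      have := congrArg (· / k) h
      simpa [Nat.add_div_of_dvd_right (Dvd.intro_left a rfl), hk,
        Nat.div_eq_of_lt i.2, Nat.div_eq_of_lt j.2, Nat.add_div_of_dvd_right (Dvd.intro_left b rfl)]
        using this
    subst h1
    have h2 : (i : ℕ) = j := by simpa using h
    rw [Fin.ext h2]
  have h1 := hind.precomp hinj
  have hp : ∀ i, IsProbabilityMeasure (μ.map (f i)) :=
    fun i => Measure.isProbabilityMeasure_map (hf i).aemeasurable
  have hblock : ∀ b : ℕ, μ.map (fun w (i : Fin k) => f (b * k + i) w)
      = Measure.infinitePi fun i : Fin k => μ.map (f (b * k + i)) := fun b =>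
    iIndepFun.map_fun_eq_infinitePi_map (fun i => hf _)
      (hind.precomp (g := fun i : Fin k => b * k + (i : ℕ)) fun i j h => Fin.ext (by simpa using h))
  rw [iIndepFun_iff_map_fun_eq_infinitePi_map fun b => measurable_pi_lambda _ fun i => hf _]
  simp_rw [hblock]
  rw [← Measure.infinitePi_map_piCurry (fun (b : ℕ) (i : Fin k) => μ.map (f (b * k + i))),
    ← iIndepFun.map_fun_eq_infinitePi_map (fun _ => hf _) h1,
    Measure.map_map (by fun_prop) (measurable_pi_lambda _ fun _ => hf _)]
  rfl

/-! ### Moments of the least squares estimator -/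

/-- The first `B * k` rows form `B` square blocks, each handled by `minSq_mul_le`; the remaining
rows only add squares. -/
theorem sum_minSq_mul_le {k : ℕ} (y : ℕ → Fin k → ℝ) (u : Fin k → ℝ) {B N : ℕ} (h : B * k ≤ N) :
    (∑ b ∈ Finset.range B, (minSq (Matrix.of fun (i : Fin k) => y (b * k + i)) : ℝ)) * (u ⬝ᵥ u)
      ≤ ∑ i ∈ Finset.range N, (y i ⬝ᵥ u) ^ 2 := by
  calc _ ≤ ∑ i ∈ Finset.range (B * k), (y i ⬝ᵥ u) ^ 2 := by
        clear h
        induction B with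
        | zero => simp
        | succ B ih =>
          rw [Finset.sum_range_succ, add_mul, Nat.succ_mul, Finset.sum_range_add]
          refine add_le_add ih ((minSq_mul_le _ u).trans (le_of_eq ?_))
          rw [← Fin.sum_univ_eq_sum_range (fun x => (y (B * k + x) ⬝ᵥ u) ^ 2)]
          simp [dotProduct, Matrix.mulVec, sq]
    _ ≤ _ := Finset.sum_le_sum_of_subset_of_nonneg (Finset.range_mono h)
        fun _ _ _ => sq_nonneg _

namespace InverseRegression

/-- The fitted values are the orthogonal projection of the observed column on the range of the `Y`
data matrix, and a projection does not increase the norm. -/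
theorem sum_sq_dotProduct_aHat_le {L D : ℕ} {W : Type*} (X : ℕ → W → Fin D → ℝ) (Y : ℕ → W → Fin L → ℝ) (N : ℕ) (w : W)
    (d : Fin D) :
    ∑ i ∈ Finset.range N, (Y i w ⬝ᵥ aHat X Y N w d) ^ 2 ≤ ∑ i ∈ Finset.range N, X i w d ^ 2 := by
  set Ym := dataMatrix N Y w with hYm
  set S := Ymᵀ * Ym with hS
  set x : Fin N → ℝ := fun i => X i w d with hx
  set a := aHat X Y N w d with ha
  have hx0 : 0 ≤ x ⬝ᵥ x := by simp only [dotProduct, ← sq]; positivity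
  have e1 : ∑ i ∈ Finset.range N, (Y i w ⬝ᵥ a) ^ 2 = (Ym *ᵥ a) ⬝ᵥ (Ym *ᵥ a) := by
    rw [← Fin.sum_univ_eq_sum_range (fun i => (Y i w ⬝ᵥ a) ^ 2)]
    simp [dotProduct, Matrix.mulVec, sq, hYm, dataMatrix]
  have e2 : ∑ i ∈ Finset.range N, X i w d ^ 2 = x ⬝ᵥ x := by
    rw [← Fin.sum_univ_eq_sum_range (fun i => X i w d ^ 2)]
    simp [dotProduct, sq, hx]
  have hrow : a = (x ᵥ* Ym) ᵥ* S⁻¹ := by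
    rw [ha, aHat, Matrix.mul_apply_eq_vecMul, Matrix.mul_apply_eq_vecMul]
    rfl
  rw [e1, e2]
  by_cases hdet : IsUnit S.det
  · have h1 : a ᵥ* S = x ᵥ* Ym := by
      rw [hrow, Matrix.vecMul_vecMul, Matrix.nonsing_inv_mul _ hdet, Matrix.vecMul_one]
    have h2 : (Ym *ᵥ a) ⬝ᵥ (Ym *ᵥ a) = x ⬝ᵥ (Ym *ᵥ a) := by
      rw [Matrix.dotProduct_mulVec x, ← h1, ← Matrix.dotProduct_mulVec, hS,
        ← Matrix.mulVec_mulVec, Matrix.dotProduct_mulVec a, Matrix.vecMul_transpose]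
    have h3 : 0 ≤ (x - Ym *ᵥ a) ⬝ᵥ (x - Ym *ᵥ a) := by
      simp only [dotProduct, ← sq]; positivity
    simp only [sub_dotProduct, dotProduct_sub] at h3
    rw [dotProduct_comm (Ym *ᵥ a) x] at h3
    linarith
  -- A singular Gram matrix has inverse `0` by convention, so the fit vanishes.
  · have : a = 0 := by rw [hrow, Matrix.nonsing_inv_apply_not_isUnit _ hdet, Matrix.vecMul_zero]
    simpa [this] using hx0

variable {L D : ℕ} {W : Type*} [MeasurableSpace W]

/-! ### Measurability and fourth moments of the estimator -/

theorem measurable_inv_apply {α : Type*} [MeasurableSpace α] {n : Type*} [Fintype n]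
    [DecidableEq n] {f : α → Matrix n n ℝ} (hf : ∀ i j, Measurable fun a => f a i j) (i j : n) :
    Measurable fun a => (f a)⁻¹ i j := by
  have h1 := measurable_det_of hf
  have h2 : Measurable fun a => (f a).adjugate i j := by
    simp only [Matrix.adjugate_apply]
    refine measurable_det_of fun i' j' => ?_
    by_cases h : i' = j
    · subst h; simp
    · simpa [Matrix.updateRow_ne h] using hf i' j'
  simp only [Matrix.inv_def, Ring.inverse_eq_inv', Matrix.smul_apply, smul_eq_mul]
  fun_prop

theorem measurable_mul_apply {α : Type*} [MeasurableSpace α] {l m n : Type*} [Fintype m]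
    {f : α → Matrix l m ℝ} {g : α → Matrix m n ℝ} (hf : ∀ i j, Measurable fun a => f a i j)
    (hg : ∀ i j, Measurable fun a => g a i j) (i : l) (j : n) :
    Measurable fun a => (f a * g a) i j := by
  simp only [Matrix.mul_apply]
  fun_prop

theorem measurable_aHat_apply {X : ℕ → W → Fin D → ℝ} {Y : ℕ → W → Fin L → ℝ}
    (hX : ∀ i, Measurable (X i)) (hY : ∀ i, Measurable (Y i)) (N : ℕ) (d : Fin D) (l : Fin L) :
    Measurable fun w => aHat X Y N w d l := by
  have hX' : ∀ i d, Measurable fun w => X i w d := fun i d => by have := hX i; fun_prop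
  have hY' : ∀ i d, Measurable fun w => Y i w d := fun i d => by have := hY i; fun_prop
  refine measurable_mul_apply (measurable_mul_apply ?_ ?_)
    (measurable_inv_apply (measurable_mul_apply ?_ ?_)) d l
  · exact fun _ _ => hX' _ _
  · exact fun _ _ => hY' _ _
  · exact fun _ _ => hY' _ _
  · exact fun _ _ => hY' _ _

/-- Convexity of `t ↦ t ^ 4`: the fourth power of a mean of squares is at most the mean of the
eighth powers. -/
theorem lintegral_mean_sq_pow_le {P : Measure W} {f : ℕ → W → ℝ} (hf : ∀ i, Measurable (f i))
    {M : ℝ≥0∞} (hM : ∀ i, ∫⁻ w, ‖f i w‖ₑ ^ 8 ∂P ≤ M) {N : ℕ} (hN : 0 < N) :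
    ∫⁻ w, ENNReal.ofReal ((∑ i ∈ Finset.range N, f i w ^ 2) / N) ^ 4 ∂P ≤ M := by
  have hN' : (0 : ℝ) < N := by exact_mod_cast hN
  have hp : ∀ w, ENNReal.ofReal ((∑ i ∈ Finset.range N, f i w ^ 2) / N) ^ 4
      ≤ (N : ℝ≥0∞)⁻¹ * ∑ i ∈ Finset.range N, ‖f i w‖ₑ ^ 8 := by
    intro w
    have h := pow_sum_div_card_le_sum_pow (s := Finset.range N) (f := fun i => f i w ^ 2)
      (fun _ _ => sq_nonneg _) 3
    rw [Finset.card_range, div_le_iff₀ (by positivity)] at h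
    have h2 : ((∑ i ∈ Finset.range N, f i w ^ 2) / N) ^ 4
        ≤ (N : ℝ)⁻¹ * ∑ i ∈ Finset.range N, |f i w| ^ 8 := by
      rw [div_pow, div_le_iff₀ (by positivity)]
      refine h.trans (le_of_eq ?_)
      have : ∀ i, (f i w ^ 2) ^ (3 + 1) = |f i w| ^ 8 := fun i => by
        rw [← sq_abs]; ring
      simp only [this]
      field_simp
    rw [← ENNReal.ofReal_pow (by positivity)]
    refine (ENNReal.ofReal_le_ofReal h2).trans (le_of_eq ?_)
    rw [ENNReal.ofReal_mul (by positivity), ENNReal.ofReal_inv_of_pos hN', ENNReal.ofReal_natCast,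
      ENNReal.ofReal_sum_of_nonneg fun _ _ => by positivity]
    simp only [Real.enorm_eq_ofReal_abs, ENNReal.ofReal_pow (abs_nonneg _)]
  calc _ ≤ ∫⁻ w, (N : ℝ≥0∞)⁻¹ * ∑ i ∈ Finset.range N, ‖f i w‖ₑ ^ 8 ∂P := lintegral_mono hp
    _ = (N : ℝ≥0∞)⁻¹ * ∑ i ∈ Finset.range N, ∫⁻ w, ‖f i w‖ₑ ^ 8 ∂P := by
        rw [lintegral_const_mul _ (by fun_prop), lintegral_finsetSum _ (by fun_prop)]
    _ ≤ (N : ℝ≥0∞)⁻¹ * ∑ _i ∈ Finset.range N, M := by gcongr with i; exact hM i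
    _ = M := by
        rw [Finset.sum_const, Finset.card_range, nsmul_eq_mul, ← mul_assoc,
          ENNReal.inv_mul_cancel (by exact_mod_cast hN.ne') (by simp), one_mul]

/-- From `a² ≤ T / σ` follows `a⁴ ≤ T² σ⁻² ≤ T⁴ + σ⁻⁴`; for `σ = 0` the right side is `∞`. -/
theorem enorm_pow_four_le {a T : ℝ} {σ : ℝ≥0} (hT : 0 ≤ T) (h : (σ : ℝ) * a ^ 2 ≤ T) :
    ‖a‖ₑ ^ 4 ≤ ENNReal.ofReal T ^ 4 + (σ : ℝ≥0∞) ^ (-4 : ℝ) := by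
  rcases eq_or_ne σ 0 with rfl | hσ
  · simp [ENNReal.zero_rpow_of_neg]
  have hσ' : (0 : ℝ) < σ := by exact_mod_cast pos_iff_ne_zero.2 hσ
  have e1 : (σ : ℝ≥0∞) ^ (-4 : ℝ) = ENNReal.ofReal (((σ : ℝ)⁻¹) ^ 4) := by
    rw [← ENNReal.ofReal_coe_nnreal, ENNReal.ofReal_rpow_of_pos hσ', Real.rpow_neg hσ'.le, inv_pow]
    norm_cast
  rw [e1, Real.enorm_eq_ofReal_abs, ← ENNReal.ofReal_pow (abs_nonneg _),
    ← ENNReal.ofReal_pow hT, ← ENNReal.ofReal_add (by positivity) (by positivity)]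
  apply ENNReal.ofReal_le_ofReal
  have h1 : a ^ 2 ≤ T * (σ : ℝ)⁻¹ := by
    rw [← div_eq_mul_inv, le_div_iff₀ hσ']; linarith
  have h2 : |a| ^ 4 = (a ^ 2) ^ 2 := by rw [← sq_abs a]; ring
  have h3 : (a ^ 2) ^ 2 ≤ (T * (σ : ℝ)⁻¹) ^ 2 := by gcongr
  rw [h2]
  nlinarith [sq_nonneg (T ^ 2 - ((σ : ℝ)⁻¹) ^ 2)]

/-- The fourth moments of the entries of the least squares estimator are bounded. -/
theorem exists_lintegral_aHat_pow_le {P : Measure W} [IsProbabilityMeasure P] (hL : 1 ≤ L)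
    {X : ℕ → W → Fin D → ℝ} {Y : ℕ → W → Fin L → ℝ} (hX : ∀ i, Measurable (X i))
    (hY : ∀ i, Measurable (Y i)) (hind : iIndepFun Y P) {ν : Measure (Fin L → ℝ)}
    (hlaw : ∀ i, P.map (Y i) = ν) {K : ℝ≥0∞} (hK : K ≠ ∞) (hν : HasNegMomentBound (1 / 2) K ν)
    (hmom : ∀ j, ∀ p : ℝ≥0∞, p ≠ ∞ → MemLp (fun y => y j) p ν)
    {M : ℝ≥0∞} (hM : M ≠ ∞) (hXM : ∀ i d, ∫⁻ w, ‖X i w d‖ₑ ^ 8 ∂P ≤ M) :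
    ∃ C : ℝ≥0∞, C ≠ ∞ ∧ ∀ᶠ N in atTop, ∀ d l, ∫⁻ w, ‖aHat X Y N w d l‖ₑ ^ 4 ∂P ≤ C := by
  have hνp : IsProbabilityMeasure ν := by
    rw [← hlaw 0]; exact Measure.isProbabilityMeasure_map (hY 0).aemeasurable
  set blk : ℕ → W → Fin L → Fin L → ℝ := fun b w i => Y (b * L + i) w with hblk
  have hblkm : ∀ b, Measurable (blk b) := fun b => measurable_pi_lambda _ fun i => hY _
  set Z : ℕ → W → ℝ≥0 := fun b w => minSq (Matrix.of (blk b w)) with hZ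
  have hminm : Measurable fun M : Fin L → Fin L → ℝ => minSq (Matrix.of M) :=
    measurable_minSq (f := fun M => Matrix.of M) fun i j => by
      simp only [Matrix.of_apply]; fun_prop
  have hZm : ∀ b, Measurable (Z b) := fun b => hminm.comp (hblkm b)
  have hZind : iIndepFun Z P :=
    (iIndepFun_block hY hind L).comp (fun _ M => minSq (Matrix.of M)) fun _ => hminm
  set C₀ := ∫⁻ M, (minSq (Matrix.of M) : ℝ≥0∞) ^ (-(1 / 8) : ℝ)
    ∂(Measure.pi fun _ : Fin L => ν) with hC₀
  have hC₀top : C₀ ≠ ∞ := lintegral_minSq_rpow_ne_top hK hν hmom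
  have hblklaw : ∀ b, P.map (blk b) = Measure.pi fun _ : Fin L => ν := by
    intro b
    have h := iIndepFun.map_fun_eq_pi_map (fun i => (hY _).aemeasurable)
      (hind.precomp (g := fun i : Fin L => b * L + (i : ℕ)) fun i j h => Fin.ext (by simpa using h))
    simp only [hlaw] at h
    exact h
  have hZC : ∀ b, ∫⁻ w, (Z b w : ℝ≥0∞) ^ (-(1 / 8) : ℝ) ∂P ≤ C₀ := by
    intro b
    rw [hC₀, ← hblklaw b, lintegral_map (by fun_prop) (hblkm b)]
  refine ⟨M + ENNReal.ofReal (2 * L) ^ (4 : ℝ) * C₀ ^ ((4 : ℝ) / (1 / 8)), ?_, ?_⟩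
  · refine ENNReal.add_ne_top.2 ⟨hM, ENNReal.mul_ne_top ?_ ?_⟩
    · exact ENNReal.rpow_ne_top_of_nonneg (by norm_num) ENNReal.ofReal_ne_top
    · exact ENNReal.rpow_ne_top_of_nonneg (by norm_num) hC₀top
  -- Raising the order from `-1/8` to `-4` needs more than `4 / (1/8) = 32` blocks.
  filter_upwards [eventually_ge_atTop (33 * L)] with N hN d l
  set B := N / L with hB
  have hB33 : 33 ≤ B := (Nat.le_div_iff_mul_le hL).2 hN
  have hBN : B * L ≤ N := Nat.div_mul_le_self N L
  have hNB : N ≤ 2 * L * B := by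
    have h1 := Nat.lt_div_mul_add (a := N) hL
    rw [← hB] at h1
    nlinarith
  have hN0 : 0 < N := by nlinarith
  have hN0' : (0 : ℝ) < N := by exact_mod_cast hN0
  -- A lower bound for the smallest eigenvalue of `YᵀY / N`.
  set σ : W → ℝ≥0 := fun w => (∑ b ∈ Finset.range B, Z b w) / N with hσ
  have hpt : ∀ w, ‖aHat X Y N w d l‖ₑ ^ 4 ≤
      ENNReal.ofReal ((∑ i ∈ Finset.range N, X i w d ^ 2) / N) ^ 4 + (σ w : ℝ≥0∞) ^ (-4 : ℝ) := by
    intro w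
    refine enorm_pow_four_le (by positivity) ?_
    have h1 := (sum_minSq_mul_le (fun i => Y i w) (aHat X Y N w d) hBN).trans
      (sum_sq_dotProduct_aHat_le X Y N w d)
    have h2 : aHat X Y N w d l ^ 2 ≤ aHat X Y N w d ⬝ᵥ aHat X Y N w d := by
      simp only [dotProduct, ← sq]
      exact Finset.single_le_sum (f := fun l => aHat X Y N w d l ^ 2) (fun _ _ => sq_nonneg _)
        (Finset.mem_univ l)
    have h3 : ((σ w : ℝ≥0) : ℝ) = (∑ b ∈ Finset.range B, (Z b w : ℝ)) / N := by
      simp [hσ]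
    rw [h3, div_mul_eq_mul_div]
    gcongr
    refine le_trans ?_ h1
    gcongr
  -- Normalizing by the number `B` of blocks instead of `N ≤ 2 L B` costs the factor `(2 L) ^ 4`.
  have hσb : ∀ w, (σ w : ℝ≥0∞) ^ (-4 : ℝ) ≤ ENNReal.ofReal (2 * L) ^ (4 : ℝ) *
      ((∑ b ∈ Finset.range B, (Z b w : ℝ≥0∞)) / B) ^ (-4 : ℝ) := by
    intro w
    have h1 : (∑ b ∈ Finset.range B, (Z b w : ℝ≥0∞)) / B ≤ ENNReal.ofReal (2 * L) * σ w := by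
      have h2 : (∑ b ∈ Finset.range B, Z b w) / (B : ℝ≥0) ≤ (2 * L : ℝ≥0) * σ w := by
        have hB0 : (0 : ℝ≥0) < B := by exact_mod_cast (by omega : 0 < B)
        have hN0'' : (0 : ℝ≥0) < N := by exact_mod_cast hN0
        rw [hσ, div_le_iff₀ hB0]
        have h3 : (N : ℝ≥0) ≤ 2 * L * B := by exact_mod_cast hNB
        calc ∑ b ∈ Finset.range B, Z b w
            = (N : ℝ≥0) * ((∑ b ∈ Finset.range B, Z b w) / N) := by field_simp
          _ ≤ (2 * L * B) * ((∑ b ∈ Finset.range B, Z b w) / N) := by gcongr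
          _ = _ := by ring
      have h4 := ENNReal.coe_le_coe.2 h2
      rw [ENNReal.coe_div (by exact_mod_cast (by omega : B ≠ 0))] at h4
      rw [show ENNReal.ofReal (2 * L) = ((2 * L : ℝ≥0) : ℝ≥0∞) by
        rw [← ENNReal.ofReal_coe_nnreal]; simp]
      push_cast at h4 ⊢
      exact h4
    have hc0 : ENNReal.ofReal (2 * L) ≠ 0 := by
      rw [ne_eq, ENNReal.ofReal_eq_zero, not_le]
      have : (1 : ℝ) ≤ L := by exact_mod_cast hL
      linarith
    have h5 := ENNReal.rpow_le_rpow h1 (by norm_num : (0 : ℝ) ≤ 4)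
    rw [ENNReal.mul_rpow_of_ne_top ENNReal.ofReal_ne_top ENNReal.coe_ne_top] at h5
    have hc1 : ENNReal.ofReal (2 * L) ^ (4 : ℝ) ≠ 0 :=
      (ENNReal.rpow_pos (pos_iff_ne_zero.2 hc0) ENNReal.ofReal_ne_top).ne'
    have hc2 : ENNReal.ofReal (2 * L) ^ (4 : ℝ) ≠ ∞ :=
      ENNReal.rpow_ne_top_of_nonneg (by norm_num) ENNReal.ofReal_ne_top
    rw [ENNReal.rpow_neg, ENNReal.rpow_neg]
    calc ((σ w : ℝ≥0∞) ^ (4 : ℝ))⁻¹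
        = ENNReal.ofReal (2 * L) ^ (4 : ℝ) *
          (ENNReal.ofReal (2 * L) ^ (4 : ℝ) * (σ w : ℝ≥0∞) ^ (4 : ℝ))⁻¹ := by
          rw [ENNReal.mul_inv (Or.inl hc1) (Or.inl hc2), ← mul_assoc,
            ENNReal.mul_inv_cancel hc1 hc2, one_mul]
      _ ≤ _ := by
          gcongr
  calc ∫⁻ w, ‖aHat X Y N w d l‖ₑ ^ 4 ∂P
      ≤ ∫⁻ w, ENNReal.ofReal ((∑ i ∈ Finset.range N, X i w d ^ 2) / N) ^ 4 +
        ENNReal.ofReal (2 * L) ^ (4 : ℝ) *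
        ((∑ b ∈ Finset.range B, (Z b w : ℝ≥0∞)) / B) ^ (-4 : ℝ) ∂P :=
        lintegral_mono fun w => (hpt w).trans (by gcongr; exact hσb w)
    _ ≤ _ := by
        have hXd : ∀ i, Measurable fun w => X i w d := fun i => by have := hX i; fun_prop
        rw [lintegral_add_left (by fun_prop), lintegral_const_mul _ (by fun_prop)]
        gcongr
        · exact lintegral_mean_sq_pow_le hXd (fun i => hXM i d) hN0
        · refine lintegral_mean_rpow_neg_le hZm hZind (by norm_num) (by norm_num) hZC ?_
          have : (33 : ℝ) ≤ B := by exact_mod_cast hB33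
          norm_num
          linarith

end InverseRegression

/-! ### Mean square convergence and covariances -/

/-- Truncate at level `M`: where `u² > M`, one has `u² ≤ u⁴ / M`. -/
theorem enorm_sq_le_min_add (u : ℝ) {M : ℝ≥0∞} (hM0 : M ≠ 0) (hM : M ≠ ∞) :
    ‖u‖ₑ ^ 2 ≤ min (‖u‖ₑ ^ 2) M + M⁻¹ * ‖u‖ₑ ^ 4 := by
  rcases le_total (‖u‖ₑ ^ 2) M with h | h
  · rw [min_eq_left h]; exact le_self_add
  · refine le_trans ?_ le_add_self
    calc ‖u‖ₑ ^ 2 = M⁻¹ * (M * ‖u‖ₑ ^ 2) := by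
          rw [← mul_assoc, ENNReal.inv_mul_cancel hM0 hM, one_mul]
      _ ≤ M⁻¹ * (‖u‖ₑ ^ 2 * ‖u‖ₑ ^ 2) := by gcongr
      _ = _ := by ring

/-- The truncated squares converge by dominated convergence; the bounded fourth moments make the
remainder at most `C / M`, uniformly in `n`. -/
theorem tendsto_lintegral_sq_of_tendsto_ae {Ω : Type*} [MeasurableSpace Ω] {μ : Measure Ω}
    [IsProbabilityMeasure μ] {U : ℕ → Ω → ℝ} (hU : ∀ n, Measurable (U n))
    (hlim : ∀ᵐ w ∂μ, Tendsto (fun n => U n w) atTop (𝓝 0)) {C : ℝ≥0∞} (hC : C ≠ ∞)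
    (hbd : ∀ᶠ n in atTop, ∫⁻ w, ‖U n w‖ₑ ^ 4 ∂μ ≤ C) :
    Tendsto (fun n => ∫⁻ w, ‖U n w‖ₑ ^ 2 ∂μ) atTop (𝓝 0) := by
  rw [ENNReal.tendsto_nhds_zero]
  intro ε hε
  rcases eq_or_ne ε ∞ with rfl | hεtop
  · simp
  -- Chosen so that `C / M ≤ ε / 2`; the summand `1` keeps `M` nonzero when `C = 0`.
  set M : ℝ≥0∞ := 1 + C / (ε / 2) with hM
  have hε2 : ε / 2 ≠ 0 := by simpa using hε.ne'
  have hMtop : M ≠ ∞ := by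
    rw [hM]
    exact ENNReal.add_ne_top.2 ⟨ENNReal.one_ne_top, ENNReal.div_ne_top hC hε2⟩
  have hM0 : M ≠ 0 := by simp [hM]
  have hMC : M⁻¹ * C ≤ ε / 2 := by
    rw [mul_comm, ← div_eq_mul_inv, ENNReal.div_le_iff hM0 hMtop]
    have : C = (ε / 2) * (C / (ε / 2)) := by
      rw [ENNReal.mul_div_cancel hε2 (ENNReal.div_ne_top hεtop (by simp))]
    calc C = (ε / 2) * (C / (ε / 2)) := this
      _ ≤ (ε / 2) * M := by gcongr; exact le_add_self
  have hdct : Tendsto (fun n => ∫⁻ w, min (‖U n w‖ₑ ^ 2) M ∂μ) atTop (𝓝 0) := by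
    have := tendsto_lintegral_of_dominated_convergence (μ := μ)
      (F := fun n w => min (‖U n w‖ₑ ^ 2) M) (f := fun _ => 0) (fun _ => M)
      (fun n => by have := hU n; fun_prop) (fun n => ae_of_all _ fun w => min_le_right _ _)
      (by simpa using hMtop) (by
        filter_upwards [hlim] with w hw
        have h1 : Tendsto (fun n => ‖U n w‖ₑ ^ 2) atTop (𝓝 0) := by
          have := (ENNReal.continuous_pow 2).continuousAt.tendsto.comp hw.enorm
          simpa [Function.comp_def] using this
        simpa using h1.min (tendsto_const_nhds (x := M)))
    simpa using this
  filter_upwards [(ENNReal.tendsto_nhds_zero.1 hdct) (ε / 2) (pos_iff_ne_zero.2 hε2), hbd]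
    with n h1 h2
  calc ∫⁻ w, ‖U n w‖ₑ ^ 2 ∂μ
      ≤ ∫⁻ w, min (‖U n w‖ₑ ^ 2) M + M⁻¹ * ‖U n w‖ₑ ^ 4 ∂μ :=
        lintegral_mono fun w => enorm_sq_le_min_add _ hM0 hMtop
    _ = ∫⁻ w, min (‖U n w‖ₑ ^ 2) M ∂μ + M⁻¹ * ∫⁻ w, ‖U n w‖ₑ ^ 4 ∂μ := by
        have := hU n
        rw [lintegral_add_left (by fun_prop), lintegral_const_mul _ (by fun_prop)]
    _ ≤ ε / 2 + M⁻¹ * C := by gcongr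
    _ ≤ ε / 2 + ε / 2 := by gcongr
    _ = ε := ENNReal.add_halves ε

theorem tendsto_eLpNorm_two_of_tendsto_ae {Ω : Type*} [MeasurableSpace Ω] {μ : Measure Ω}
    [IsProbabilityMeasure μ] {U : ℕ → Ω → ℝ} (hU : ∀ n, Measurable (U n))
    (hlim : ∀ᵐ w ∂μ, Tendsto (fun n => U n w) atTop (𝓝 0)) {C : ℝ≥0∞} (hC : C ≠ ∞)
    (hbd : ∀ᶠ n in atTop, ∫⁻ w, ‖U n w‖ₑ ^ 4 ∂μ ≤ C) :
    Tendsto (fun n => eLpNorm (U n) 2 μ) atTop (𝓝 0) := by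
  have h := tendsto_lintegral_sq_of_tendsto_ae hU hlim hC hbd
  have h2 := (ENNReal.continuous_rpow_const (y := 1 / 2)).continuousAt.tendsto.comp h
  simp only [eLpNorm_eq_lintegral_rpow_enorm_toReal two_ne_zero ENNReal.ofNat_ne_top,
    ENNReal.toReal_ofNat, ENNReal.rpow_ofNat]
  simpa [Function.comp_def] using h2

theorem tendsto_eLpNorm_sum {Ω ι : Type*} [MeasurableSpace Ω] {μ : Measure Ω} {p : ℝ≥0∞}
    (hp : 1 ≤ p) (s : Finset ι) {U : ι → ℕ → Ω → ℝ} (hU : ∀ i n, Measurable (U i n))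
    (h : ∀ i, Tendsto (fun n => eLpNorm (U i n) p μ) atTop (𝓝 0)) (c : ι → ℝ) :
    Tendsto (fun n => eLpNorm (fun w => ∑ i ∈ s, c i * U i n w) p μ) atTop (𝓝 0) := by
  have hsum : Tendsto (fun n => ∑ i ∈ s, ‖c i‖ₑ * eLpNorm (U i n) p μ) atTop (𝓝 0) := by
    have : Tendsto (fun n => ∑ i ∈ s, ‖c i‖ₑ * eLpNorm (U i n) p μ) atTop
        (𝓝 (∑ i ∈ s, ‖c i‖ₑ * 0)) :=
      tendsto_finsetSum s fun i _ => ENNReal.Tendsto.const_mul (h i) (Or.inr (by simp))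
    simpa using this
  refine tendsto_of_tendsto_of_tendsto_of_le_of_le tendsto_const_nhds hsum (fun _ => zero_le)
    fun n => ?_
  have e : (fun w => ∑ i ∈ s, c i * U i n w) = ∑ i ∈ s, c i • U i n := by
    ext w; simp
  simp only [e]
  refine (eLpNorm_sum_le (fun i _ => ((hU i n).const_smul (c i)).aestronglyMeasurable) hp).trans
    (Finset.sum_le_sum fun i _ => ?_)
  rw [eLpNorm_const_smul]

theorem tendsto_integral_of_tendsto_eLpNorm_one {Ω : Type*} [MeasurableSpace Ω] {μ : Measure Ω}
    {f : ℕ → Ω → ℝ} (h : Tendsto (fun n => eLpNorm (f n) 1 μ) atTop (𝓝 0)) :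
    Tendsto (fun n => ∫ w, f n w ∂μ) atTop (𝓝 0) := by
  rw [tendsto_zero_iff_enorm_tendsto_zero]
  refine tendsto_of_tendsto_of_tendsto_of_le_of_le tendsto_const_nhds h (fun _ => zero_le)
    fun n => ?_
  rw [eLpNorm_one_eq_lintegral_enorm]
  exact enorm_integral_le_lintegral_enorm _

theorem tendsto_covariance_of_tendsto_eLpNorm {Ω : Type*} [MeasurableSpace Ω] {μ : Measure Ω}
    [IsProbabilityMeasure μ] {U V : ℕ → Ω → ℝ} (hUm : ∀ n, Measurable (U n))
    (hVm : ∀ n, Measurable (V n)) (hU : Tendsto (fun n => eLpNorm (U n) 2 μ) atTop (𝓝 0))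
    (hV : Tendsto (fun n => eLpNorm (V n) 2 μ) atTop (𝓝 0)) :
    Tendsto (fun n => cov[U n, V n; μ]) atTop (𝓝 0) := by
  have h1 : ∀ {Z : ℕ → Ω → ℝ}, (∀ n, Measurable (Z n)) →
      Tendsto (fun n => eLpNorm (Z n) 2 μ) atTop (𝓝 0) →
      Tendsto (fun n => ∫ w, Z n w ∂μ) atTop (𝓝 0) := fun hZm hZ =>
    tendsto_integral_of_tendsto_eLpNorm_one
      (tendsto_of_tendsto_of_tendsto_of_le_of_le tendsto_const_nhds hZ (fun _ => zero_le)
        fun n => eLpNorm_le_eLpNorm_of_exponent_le (by norm_num) (hZm n).aestronglyMeasurable)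
  have h2 : Tendsto (fun n => ∫ w, (U n * V n) w ∂μ) atTop (𝓝 0) := by
    refine tendsto_integral_of_tendsto_eLpNorm_one ?_
    have h3 : Tendsto (fun n => eLpNorm (U n) 2 μ * eLpNorm (V n) 2 μ) atTop (𝓝 0) := by
      simpa using ENNReal.Tendsto.mul hU (Or.inr (by simp)) hV (Or.inr (by simp))
    refine tendsto_of_tendsto_of_tendsto_of_le_of_le tendsto_const_nhds h3 (fun _ => zero_le)
      fun n => ?_
    exact eLpNorm_smul_le_mul_eLpNorm (p := 2) (q := 2) (r := 1) (f := V n) (φ := U n)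
      (hVm n).aestronglyMeasurable (hUm n).aestronglyMeasurable
  -- Expanding the covariance needs square integrability, which is available only for large `n`.
  have hlt : ∀ {Z : ℕ → Ω → ℝ}, Tendsto (fun n => eLpNorm (Z n) 2 μ) atTop (𝓝 0) →
      ∀ᶠ n in atTop, eLpNorm (Z n) 2 μ < ∞ := fun hZ =>
    hZ.eventually (gt_mem_nhds ENNReal.zero_lt_top)
  have h4 : Tendsto (fun n => ∫ w, (U n * V n) w ∂μ - (∫ w, U n w ∂μ) * ∫ w, V n w ∂μ) atTop
      (𝓝 0) := by
    simpa using h2.sub ((h1 hUm hU).mul (h1 hVm hV))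
  refine h4.congr' ?_
  filter_upwards [hlt hU, hlt hV] with n hn1 hn2
  rw [covariance_eq_sub ⟨(hUm n).aestronglyMeasurable, hn1⟩ ⟨(hVm n).aestronglyMeasurable, hn2⟩]

/-! ### Vanishing of `Θ` and `Ω` -/

namespace InverseRegression

/-- Linearity of `Dg(A)` is all that is used of the differential: its entries are fixed linear
combinations of those of `Â - A`. -/
theorem linearizedError_vec_eq_sum {L D : ℕ} {W : Type*} (Gam : Matrix (Fin L) (Fin L) ℝ) (A : Matrix (Fin D) (Fin L) ℝ)
    (Sig : Matrix (Fin D) (Fin D) ℝ) (X : ℕ → W → Fin D → ℝ) (Y : ℕ → W → Fin L → ℝ)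
    (N : ℕ) (w : W) (p : Fin D × Fin L) :
    (linearizedError Gam A Sig X Y N w).vec p = ∑ q : Fin D × Fin L,
      (fderiv ℝ (aStar Gam Sig) A (Matrix.single q.1 q.2 1)).vec p *
        (aHat X Y N w q.1 q.2 - A q.1 q.2) := by
  rw [linearizedError]
  set T := fderiv ℝ (aStar Gam Sig) A
  have h : aHat X Y N w - A = ∑ q : Fin D × Fin L,
      (aHat X Y N w q.1 q.2 - A q.1 q.2) • Matrix.single q.1 q.2 (1 : ℝ) := by
    rw [Fintype.sum_prod_type, Matrix.matrix_eq_sum_single (aHat X Y N w - A)]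
    simp [Matrix.smul_single]
  rw [h, map_sum]
  simp only [map_smul, Matrix.vec, Matrix.sum_apply, Matrix.smul_apply, smul_eq_mul]
  exact Finset.sum_congr rfl fun q _ => mul_comm _ _

variable {L D : ℕ} {W : Type*} [MeasurableSpace W]

theorem tendsto_theta {P : Measure W} [IsProbabilityMeasure P] {Gam : Matrix (Fin L) (Fin L) ℝ}
    {A : Matrix (Fin D) (Fin L) ℝ} {Sig : Matrix (Fin D) (Fin D) ℝ} {X : ℕ → W → Fin D → ℝ}
    {Y : ℕ → W → Fin L → ℝ} (hX : ∀ i, Measurable (X i)) (hY : ∀ i, Measurable (Y i))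
    (hlim : ∀ᵐ w ∂P, ∀ d l, Tendsto (fun N => aHat X Y N w d l) atTop (𝓝 (A d l)))
    {C : ℝ≥0∞} (hC : C ≠ ∞)
    (hbd : ∀ᶠ N in atTop, ∀ d l, ∫⁻ w, ‖aHat X Y N w d l‖ₑ ^ 4 ∂P ≤ C) (p q : Fin D × Fin L) :
    Tendsto (fun N => theta P Gam A Sig X Y N p q) atTop (𝓝 0) := by
  have hUm : ∀ (r : Fin D × Fin L) N, Measurable fun w => aHat X Y N w r.1 r.2 - A r.1 r.2 :=
    fun r N => (measurable_aHat_apply hX hY N _ _).sub_const _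
  have hU : ∀ r : Fin D × Fin L,
      Tendsto (fun N => eLpNorm (fun w => aHat X Y N w r.1 r.2 - A r.1 r.2) 2 P) atTop (𝓝 0) := by
    intro r
    refine tendsto_eLpNorm_two_of_tendsto_ae (hUm r) ?_
      (C := 16 * (C + ‖A r.1 r.2‖ₑ ^ 4)) ?_ ?_
    · filter_upwards [hlim] with w hw
      simpa using (hw r.1 r.2).sub_const (A r.1 r.2)
    · exact ENNReal.mul_ne_top (by norm_num) (ENNReal.add_ne_top.2 ⟨hC, by simp⟩)
    · filter_upwards [hbd] with N hN
      have hpt : ∀ w, ‖aHat X Y N w r.1 r.2 - A r.1 r.2‖ₑ ^ 4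
          ≤ 16 * (‖aHat X Y N w r.1 r.2‖ₑ ^ 4 + ‖A r.1 r.2‖ₑ ^ 4) := by
        intro w
        set a := ‖aHat X Y N w r.1 r.2‖ₑ
        set b := ‖A r.1 r.2‖ₑ
        calc _ ≤ (a + b) ^ 4 := by gcongr; exact enorm_sub_le
          _ ≤ (2 * max a b) ^ 4 := by
              gcongr
              rw [two_mul]
              exact add_le_add (le_max_left _ _) (le_max_right _ _)
          _ = 16 * (max a b) ^ 4 := by rw [mul_pow]; norm_num
          _ ≤ _ := by
              gcongr
              rcases max_choice a b with h | h <;> rw [h]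
              · exact le_self_add
              · exact le_add_self
      have hm := measurable_aHat_apply hX hY N r.1 r.2
      calc _ ≤ ∫⁻ w, 16 * (‖aHat X Y N w r.1 r.2‖ₑ ^ 4 + ‖A r.1 r.2‖ₑ ^ 4) ∂P :=
            lintegral_mono hpt
        _ = 16 * (∫⁻ w, ‖aHat X Y N w r.1 r.2‖ₑ ^ 4 ∂P + ‖A r.1 r.2‖ₑ ^ 4) := by
            rw [lintegral_const_mul _ (by fun_prop), lintegral_add_left (by fun_prop)]
            simp
        _ ≤ _ := by gcongr; exact hN _ _
  simp only [theta, Matrix.of_apply, linearizedError_vec_eq_sum]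
  refine tendsto_covariance_of_tendsto_eLpNorm ?_ ?_ ?_ ?_
  · exact fun N => Finset.measurable_sum _ fun r _ => (hUm r N).const_mul _
  · exact fun N => Finset.measurable_sum _ fun r _ => (hUm r N).const_mul _
  · exact tendsto_eLpNorm_sum (by norm_num) _ hUm hU _
  · exact tendsto_eLpNorm_sum (by norm_num) _ hUm hU _

theorem tendsto_omega {P : Measure W} {Gam : Matrix (Fin L) (Fin L) ℝ}
    {A : Matrix (Fin D) (Fin L) ℝ} {Sig : Matrix (Fin D) (Fin D) ℝ} {X : ℕ → W → Fin D → ℝ}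
    {Y : ℕ → W → Fin L → ℝ}
    (h : ∀ p q, Tendsto (fun N => theta P Gam A Sig X Y N p q) atTop (𝓝 0)) (x : Fin D → ℝ) :
    Tendsto (fun N => omega P Gam A Sig X Y N x) atTop (𝓝 0) := by
  have h1 : Tendsto (fun N => theta P Gam A Sig X Y N) atTop (𝓝 0) :=
    tendsto_pi_nhds.2 fun p => tendsto_pi_nhds.2 fun q => h p q
  have hc : Continuous fun T : Matrix (Fin D × Fin L) (Fin D × Fin L) ℝ =>
      rowKron L x * T * (rowKron L x)ᵀ := by fun_prop
  simpa [Function.comp_def, omega] using (hc.tendsto 0).comp h1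

end InverseRegression

/-! ### Moments of Gaussian vectors -/

section GaussianVector

variable {W : Type*} [MeasurableSpace W] {P : Measure W} {k : ℕ} {S : Matrix (Fin k) (Fin k) ℝ}
  {Z : W → Fin k → ℝ}

theorem memLp_apply_of_hasLaw_multivariateGaussian
    (h : HasLaw (fun w => WithLp.toLp 2 (Z w)) (multivariateGaussian 0 S) P) (i : Fin k)
    {p : ℝ≥0∞} (hp : p ≠ ∞) : MemLp (fun w => Z w i) p P := by
  have h1 : MemLp (fun y : EuclideanSpace ℝ (Fin k) => y i) p (multivariateGaussian 0 S) :=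
    (EuclideanSpace.proj (𝕜 := ℝ) i).comp_memLp' (IsGaussian.memLp_id _ p hp)
  rw [← h.map_eq] at h1
  exact h1.comp_of_map h.aemeasurable

theorem integral_apply_of_hasLaw_multivariateGaussian
    (h : HasLaw (fun w => WithLp.toLp 2 (Z w)) (multivariateGaussian 0 S) P) (i : Fin k) :
    ∫ w, Z w i ∂P = 0 := by
  have h1 := h.integral_comp (f := fun y : EuclideanSpace ℝ (Fin k) => y i)
    (by fun_prop)
  have h2 := (EuclideanSpace.proj (𝕜 := ℝ) i).integral_comp_id_comm
    (μ := multivariateGaussian (0 : EuclideanSpace ℝ (Fin k)) S) IsGaussian.integrable_id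
  rw [integral_id_multivariateGaussian, map_zero] at h2
  exact h1.trans h2

theorem integral_mul_of_hasLaw_multivariateGaussian [IsProbabilityMeasure P]
    (h : HasLaw (fun w => WithLp.toLp 2 (Z w)) (multivariateGaussian 0 S) P) (hS : S.PosSemidef)
    (i j : Fin k) : ∫ w, Z w i * Z w j ∂P = S i j := by
  have h1 := h.covariance_fun_comp (f := fun y : EuclideanSpace ℝ (Fin k) => y i)
    (g := fun y : EuclideanSpace ℝ (Fin k) => y j) (by fun_prop) (by fun_prop)
  rw [covariance_eval_multivariateGaussian hS,
    covariance_eq_sub (memLp_apply_of_hasLaw_multivariateGaussian h i (by simp))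
      (memLp_apply_of_hasLaw_multivariateGaussian h j (by simp))] at h1
  rw [integral_apply_of_hasLaw_multivariateGaussian h i] at h1
  simpa using h1

theorem map_eq_of_hasLaw_multivariateGaussian
    (h : HasLaw (fun w => WithLp.toLp 2 (Z w)) (multivariateGaussian 0 S) P) (hZ : Measurable Z) :
    P.map Z = (multivariateGaussian 0 S).map WithLp.ofLp := by
  rw [← h.map_eq, Measure.map_map (by fun_prop) (by fun_prop)]
  rfl

end GaussianVector

namespace InverseRegression

variable {L D : ℕ} {Gam : Matrix (Fin L) (Fin L) ℝ} {A : Matrix (Fin D) (Fin L) ℝ}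
  {Sig : Matrix (Fin D) (Fin D) ℝ}

/-! ### Identities between forward and inverse parameters -/

theorem posDef_precision (hGam : Gam.PosDef) (hSig : Sig.PosDef) :
    (Gam⁻¹ + Aᵀ * Sig⁻¹ * A).PosDef := by
  have h := hSig.inv.posSemidef.conjTranspose_mul_mul_same A
  rw [Matrix.conjTranspose_eq_transpose_of_trivial] at h
  exact hGam.inv.add_posSemidef h

theorem posDef_sigStar (hGam : Gam.PosDef) (hSig : Sig.PosDef) : (sigStar Gam A Sig).PosDef :=
  (posDef_precision hGam hSig).inv

theorem posDef_gamStar (hGam : Gam.PosDef) (hSig : Sig.PosDef) : (gamStar Gam A Sig).PosDef := by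
  have h := hGam.posSemidef.mul_mul_conjTranspose_same A
  rw [Matrix.conjTranspose_eq_transpose_of_trivial] at h
  exact hSig.add_posSemidef h

theorem transpose_eq_of_posDef {n : Type*} {M : Matrix n n ℝ} (h : M.PosDef) : Mᵀ = M := by
  simpa using h.1.eq

/-- With `M = Γ⁻¹ + Aᵀ Σ⁻¹ A`, expansion gives `Aᵀ Σ⁻¹ Γ⋆ = M Γ Aᵀ`. This product is the
cross-covariance of `y` and `x`. -/
theorem aStar_mul_gamStar (hGam : Gam.PosDef) (hSig : Sig.PosDef) :
    aStar Gam Sig A * gamStar Gam A Sig = Gam * Aᵀ := by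
  have hG : IsUnit Gam.det := hGam.det_pos.ne'.isUnit
  have hS : IsUnit Sig.det := hSig.det_pos.ne'.isUnit
  have hM : IsUnit (Gam⁻¹ + Aᵀ * Sig⁻¹ * A).det := (posDef_precision hGam hSig).det_pos.ne'.isUnit
  have h : Aᵀ * Sig⁻¹ * gamStar Gam A Sig = (Gam⁻¹ + Aᵀ * Sig⁻¹ * A) * (Gam * Aᵀ) := by
    rw [gamStar, Matrix.mul_add, Matrix.add_mul, Matrix.mul_assoc Aᵀ Sig⁻¹ Sig,
      Matrix.nonsing_inv_mul _ hS, Matrix.mul_one, ← Matrix.mul_assoc Gam⁻¹,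
      Matrix.nonsing_inv_mul _ hG, Matrix.one_mul]
    simp only [Matrix.mul_assoc]
  rw [aStar, Matrix.mul_assoc, Matrix.mul_assoc, ← Matrix.mul_assoc Aᵀ, h, ← Matrix.mul_assoc,
    Matrix.nonsing_inv_mul _ hM, Matrix.one_mul]

theorem gamStar_mul_aStar_transpose (hGam : Gam.PosDef) (hSig : Sig.PosDef) :
    gamStar Gam A Sig * (aStar Gam Sig A)ᵀ = A * Gam := by
  have h := congrArg Matrix.transpose (aStar_mul_gamStar (A := A) hGam hSig)
  simpa [Matrix.transpose_mul, transpose_eq_of_posDef (posDef_gamStar (A := A) hGam hSig),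
    transpose_eq_of_posDef hGam] using h

/-- The left side is the covariance of `y` computed from the forward model. The identity reduces to
`Aᵀ Σ⁻¹ A Γ + 1 = M Γ`. -/
theorem aStar_mul_gamStar_mul_add_sigStar (hGam : Gam.PosDef) (hSig : Sig.PosDef) :
    aStar Gam Sig A * gamStar Gam A Sig * (aStar Gam Sig A)ᵀ + sigStar Gam A Sig = Gam := by
  have hG : IsUnit Gam.det := hGam.det_pos.ne'.isUnit
  have hM : IsUnit (Gam⁻¹ + Aᵀ * Sig⁻¹ * A).det := (posDef_precision hGam hSig).det_pos.ne'.isUnit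
  rw [Matrix.mul_assoc, gamStar_mul_aStar_transpose hGam hSig, aStar, sigStar]
  set M := Gam⁻¹ + Aᵀ * Sig⁻¹ * A with hMdef
  have h : Aᵀ * Sig⁻¹ * (A * Gam) + 1 = M * Gam := by
    rw [hMdef, Matrix.add_mul, Matrix.nonsing_inv_mul _ hG, add_comm]
    simp only [Matrix.mul_assoc]
  calc M⁻¹ * Aᵀ * Sig⁻¹ * (A * Gam) + M⁻¹ = M⁻¹ * (Aᵀ * Sig⁻¹ * (A * Gam) + 1) := by
        rw [Matrix.mul_add, Matrix.mul_one]
        simp only [Matrix.mul_assoc]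
    _ = Gam := by rw [h, ← Matrix.mul_assoc, Matrix.nonsing_inv_mul _ hM, Matrix.one_mul]

/-! ### The law of the observations -/

theorem measurable_mulVec {W : Type*} [MeasurableSpace W] {m n : ℕ} {Z : W → Fin m → ℝ} (hZ : Measurable Z)
    (B : Matrix (Fin n) (Fin m) ℝ) : Measurable fun w => B *ᵥ Z w := by
  refine measurable_pi_lambda _ fun i => ?_
  simp only [Matrix.mulVec, dotProduct]
  fun_prop

theorem charFun_map_toLp_mulVec {W : Type*} [MeasurableSpace W] {P : Measure W} {m n : ℕ} {Z : W → Fin m → ℝ} (hZ : Measurable Z)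
    (B : Matrix (Fin n) (Fin m) ℝ) (t : EuclideanSpace ℝ (Fin n)) :
    charFun (P.map fun w => WithLp.toLp 2 (B *ᵥ Z w)) t
      = charFun (P.map fun w => WithLp.toLp 2 (Z w)) (WithLp.toLp 2 (Bᵀ *ᵥ WithLp.ofLp t)) := by
  have hB := measurable_mulVec hZ B
  rw [charFun_apply, charFun_apply, integral_map (by fun_prop) (by fun_prop),
    integral_map (by fun_prop) (by fun_prop)]
  refine integral_congr_ae (ae_of_all _ fun w => ?_)
  have : inner ℝ (WithLp.toLp 2 (B *ᵥ Z w)) t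
      = inner ℝ (WithLp.toLp 2 (Z w)) (WithLp.toLp 2 (Bᵀ *ᵥ WithLp.ofLp t)) := by
    rw [EuclideanSpace.inner_eq_star_dotProduct, EuclideanSpace.inner_eq_star_dotProduct]
    simp only [star_trivial]
    rw [Matrix.dotProduct_mulVec, Matrix.mulVec_transpose]
  simp only [this]

variable {W : Type*} [MeasurableSpace W] {P : Measure W} [IsProbabilityMeasure P]
  {X : ℕ → W → Fin D → ℝ} {Y : ℕ → W → Fin L → ℝ}

/-- The characteristic functions of the independent Gaussian summands `A⋆ x` and `ε` multiply, and
their covariances add up to `Γ`. -/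
theorem IsForwardModel.hasLaw_Y
    (h : IsForwardModel P (gamStar Gam A Sig) (aStar Gam Sig A) (sigStar Gam A Sig) X Y)
    (hGam : Gam.PosDef) (hSig : Sig.PosDef) (i : ℕ) :
    HasLaw (fun w => WithLp.toLp 2 (Y i w)) (multivariateGaussian 0 Gam) P := by
  have hXm := h.measurable_X i
  have hYm := h.measurable_Y i
  refine ⟨by fun_prop, ?_⟩
  set B := aStar Gam Sig A with hB
  have hBX := measurable_mulVec hXm B
  have hsum : (fun w => WithLp.toLp 2 (Y i w))
      = fun w => WithLp.toLp 2 (B *ᵥ X i w) + WithLp.toLp 2 (Y i w - B *ᵥ X i w) := by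
    ext w j
    simp
  have hind : IndepFun (fun w => WithLp.toLp 2 (B *ᵥ X i w))
      (fun w => WithLp.toLp 2 (Y i w - B *ᵥ X i w)) P :=
    (h.indep_noise i).comp (φ := fun x => WithLp.toLp 2 (B *ᵥ x)) (ψ := WithLp.toLp 2)
      (by have := measurable_mulVec (measurable_id (α := Fin D → ℝ)) B; fun_prop) (by fun_prop)
  have : IsProbabilityMeasure (P.map fun w => WithLp.toLp 2 (Y i w)) :=
    Measure.isProbabilityMeasure_map (by fun_prop)
  refine Measure.ext_of_charFun (E := EuclideanSpace ℝ (Fin L)) (funext fun t => ?_)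
  rw [hsum, hind.charFun_map_fun_add_eq_mul (by fun_prop) (by fun_prop), Pi.mul_apply,
    charFun_map_toLp_mulVec hXm, (h.law_X i).map_eq, (h.law_noise i).map_eq,
    charFun_multivariateGaussian (posDef_gamStar hGam hSig).posSemidef,
    charFun_multivariateGaussian (posDef_sigStar hGam hSig).posSemidef,
    charFun_multivariateGaussian hGam.posSemidef, ← Complex.exp_add]
  congr 1
  have key : WithLp.ofLp t ⬝ᵥ Gam *ᵥ WithLp.ofLp t
      = (Bᵀ *ᵥ WithLp.ofLp t) ⬝ᵥ gamStar Gam A Sig *ᵥ (Bᵀ *ᵥ WithLp.ofLp t)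
        + WithLp.ofLp t ⬝ᵥ sigStar Gam A Sig *ᵥ WithLp.ofLp t := by
    conv_lhs => rw [← aStar_mul_gamStar_mul_add_sigStar (A := A) hGam hSig]
    rw [Matrix.add_mulVec, dotProduct_add, ← hB, ← Matrix.mulVec_mulVec, ← Matrix.mulVec_mulVec,
      Matrix.dotProduct_mulVec _ B, ← Matrix.mulVec_transpose]
  rw [key]
  push_cast
  simp only [inner_zero_right]
  push_cast
  ring

/-- The noise is centred and independent of `x`, so only `Γ⋆ A⋆ᵀ = A Γ` remains. -/
theorem IsForwardModel.integral_X_mul_Y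
    (h : IsForwardModel P (gamStar Gam A Sig) (aStar Gam Sig A) (sigStar Gam A Sig) X Y)
    (hGam : Gam.PosDef) (hSig : Sig.PosDef) (i : ℕ) (d : Fin D) (l : Fin L) :
    ∫ w, X i w d * Y i w l ∂P = (A * Gam) d l := by
  set B := aStar Gam Sig A with hB
  have hX2 : ∀ d, MemLp (fun w => X i w d) 2 P := fun d =>
    memLp_apply_of_hasLaw_multivariateGaussian (h.law_X i) d (by simp)
  have he2 : MemLp (fun w => (Y i w - B *ᵥ X i w) l) 2 P :=
    memLp_apply_of_hasLaw_multivariateGaussian (h.law_noise i) l (by simp)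
  have hsplit : ∀ w, X i w d * Y i w l = ∑ d', B l d' * (X i w d * X i w d')
      + X i w d * (Y i w - B *ᵥ X i w) l := by
    intro w
    have e : ∑ d', B l d' * (X i w d * X i w d') = X i w d * ∑ d', B l d' * X i w d' := by
      rw [Finset.mul_sum]
      exact Finset.sum_congr rfl fun d' _ => by ring
    rw [e, Pi.sub_apply, show (B *ᵥ X i w) l = ∑ d', B l d' * X i w d' from rfl]
    ring
  have hind : IndepFun (fun w => X i w d) (fun w => (Y i w - B *ᵥ X i w) l) P :=
    (h.indep_noise i).comp (φ := fun x : Fin D → ℝ => x d) (ψ := fun e : Fin L → ℝ => e l)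
      (measurable_pi_apply d) (measurable_pi_apply l)
  simp only [hsplit]
  rw [integral_add, integral_finsetSum]
  · simp only [integral_const_mul]
    rw [hind.integral_fun_mul_eq_mul_integral (hX2 d).aestronglyMeasurable he2.aestronglyMeasurable,
      integral_apply_of_hasLaw_multivariateGaussian (h.law_X i), zero_mul, add_zero,
      ← gamStar_mul_aStar_transpose hGam hSig, Matrix.mul_apply]
    refine Finset.sum_congr rfl fun d' _ => ?_
    rw [integral_mul_of_hasLaw_multivariateGaussian (h.law_X i)
      (posDef_gamStar hGam hSig).posSemidef, Matrix.transpose_apply, mul_comm]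
  · exact fun d' _ => ((hX2 d).integrable_mul (hX2 d')).const_mul _
  · exact integrable_finsetSum _ fun d' _ => ((hX2 d).integrable_mul (hX2 d')).const_mul _
  · exact (hX2 d).integrable_mul he2

theorem IsForwardModel.map_pair {GamS : Matrix (Fin D) (Fin D) ℝ} {AS : Matrix (Fin L) (Fin D) ℝ}
    {SigS : Matrix (Fin L) (Fin L) ℝ} (h : IsForwardModel P GamS AS SigS X Y) (i : ℕ) :
    P.map (fun w => (X i w, Y i w - AS *ᵥ X i w)) =
      ((multivariateGaussian 0 GamS).map WithLp.ofLp).prod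
        ((multivariateGaussian 0 SigS).map WithLp.ofLp) := by
  have hXm := h.measurable_X i
  have hYm := h.measurable_Y i
  have hBX := measurable_mulVec hXm AS
  rw [(indepFun_iff_map_prod_eq_prod_map_map (by fun_prop) (by fun_prop)).1 (h.indep_noise i),
    map_eq_of_hasLaw_multivariateGaussian (h.law_X i) hXm,
    map_eq_of_hasLaw_multivariateGaussian (h.law_noise i) (by fun_prop)]

/-- The pair `(x, y)` is a fixed function of `(x, ε)`, whose law is a product with factors
independent of the index. -/
theorem IsForwardModel.identDistrib {GamS : Matrix (Fin D) (Fin D) ℝ}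
    {AS : Matrix (Fin L) (Fin D) ℝ} {SigS : Matrix (Fin L) (Fin L) ℝ}
    (h : IsForwardModel P GamS AS SigS X Y) (i j : ℕ) :
    IdentDistrib (fun w => (X i w, Y i w)) (fun w => (X j w, Y j w)) P P := by
  have hm : ∀ i, Measurable fun w => (X i w, Y i w - AS *ᵥ X i w) := fun i => by
    have hXm := h.measurable_X i
    have hYm := h.measurable_Y i
    have hBX := measurable_mulVec hXm AS
    fun_prop
  have h1 : IdentDistrib (fun w => (X i w, Y i w - AS *ᵥ X i w))
      (fun w => (X j w, Y j w - AS *ᵥ X j w)) P P :=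
    ⟨(hm i).aemeasurable, (hm j).aemeasurable, by rw [h.map_pair, h.map_pair]⟩
  have h2 := h1.comp (u := fun p : (Fin D → ℝ) × (Fin L → ℝ) => (p.1, p.2 + AS *ᵥ p.1)) (by
    have := measurable_mulVec (measurable_fst (α := Fin D → ℝ) (β := Fin L → ℝ)) AS
    fun_prop)
  simpa [Function.comp_def] using h2

/-! ### Strong consistency -/

theorem IsForwardModel.ae_tendsto_mean {GamS : Matrix (Fin D) (Fin D) ℝ}
    {AS : Matrix (Fin L) (Fin D) ℝ} {SigS : Matrix (Fin L) (Fin L) ℝ}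
    (h : IsForwardModel P GamS AS SigS X Y) {φ : (Fin D → ℝ) × (Fin L → ℝ) → ℝ}
    (hφ : Measurable φ) (hint : Integrable (fun w => φ (X 0 w, Y 0 w)) P) :
    ∀ᵐ w ∂P, Tendsto (fun N : ℕ => (N : ℝ)⁻¹ * ∑ i ∈ Finset.range N, φ (X i w, Y i w)) atTop
      (𝓝 (∫ w, φ (X 0 w, Y 0 w) ∂P)) := by
  have := strong_law_ae_real (μ := P) (fun i w => φ (X i w, Y i w)) hint
    (fun i j hij => (h.indep.indepFun hij).comp hφ hφ)
    (fun i => (h.identDistrib i 0).comp hφ)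
  simpa [div_eq_inv_mul] using this

theorem aHat_eq_mean_mul_inv {W : Type*} (X : ℕ → W → Fin D → ℝ) (Y : ℕ → W → Fin L → ℝ) {N : ℕ}
    (hN : 0 < N) (w : W) :
    aHat X Y N w =
      (Matrix.of fun d l => (N : ℝ)⁻¹ * ∑ i ∈ Finset.range N, X i w d * Y i w l) *
      (Matrix.of fun l m => (N : ℝ)⁻¹ * ∑ i ∈ Finset.range N, Y i w l * Y i w m)⁻¹ := by
  have hN' : (N : ℝ) ≠ 0 := by exact_mod_cast hN.ne'
  have e : ∀ {m n : ℕ} (U : ℕ → W → Fin m → ℝ) (V : ℕ → W → Fin n → ℝ),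
      (Matrix.of fun d l => (N : ℝ)⁻¹ * ∑ i ∈ Finset.range N, U i w d * V i w l)
        = (N : ℝ)⁻¹ • ((dataMatrix N U w)ᵀ * dataMatrix N V w) := by
    intro m n U V
    ext d l
    simp only [Matrix.of_apply, Matrix.smul_apply, Matrix.mul_apply, Matrix.transpose_apply,
      dataMatrix, smul_eq_mul]
    rw [Fin.sum_univ_eq_sum_range (fun i => U i w d * V i w l)]
  rw [e X Y, e Y Y, aHat]
  set T := (dataMatrix N Y w)ᵀ * dataMatrix N Y w
  by_cases hT : IsUnit T.det
  · have h1 := Matrix.inv_smul' (A := T) (Units.mk0 (N : ℝ)⁻¹ (inv_ne_zero hN')) hT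
    have h2 : ((N : ℝ)⁻¹ • T)⁻¹ = (N : ℝ) • T⁻¹ := by
      rw [Units.smul_def] at h1
      rw [Units.val_mk0] at h1
      rw [h1, Units.smul_def]
      simp
    rw [h2, Matrix.smul_mul, Matrix.mul_smul, smul_smul, inv_mul_cancel₀ hN', one_smul]
  -- In the singular case both inverses are `0` by convention, so no invertibility assumption is
  -- needed.
  · have hT' : ¬ IsUnit ((N : ℝ)⁻¹ • T).det := by
      rw [Matrix.det_smul]
      simpa [hN'] using hT
    rw [Matrix.nonsing_inv_apply_not_isUnit _ hT, Matrix.nonsing_inv_apply_not_isUnit _ hT',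
      Matrix.mul_zero, Matrix.mul_zero]

theorem continuousAt_inv_of_isUnit_det {n : ℕ} {M : Matrix (Fin n) (Fin n) ℝ} (h : M.det ≠ 0) :
    ContinuousAt Inv.inv M := by
  refine continuousAt_matrix_inv _ ?_
  rw [Ring.inverse_eq_inv']
  exact continuousAt_inv₀ h

/-- Strong consistency of the least squares estimator. -/
theorem IsForwardModel.ae_tendsto_aHat
    (h : IsForwardModel P (gamStar Gam A Sig) (aStar Gam Sig A) (sigStar Gam A Sig) X Y)
    (hGam : Gam.PosDef) (hSig : Sig.PosDef) :
    ∀ᵐ w ∂P, Tendsto (fun N => aHat X Y N w) atTop (𝓝 A) := by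
  have hX2 : ∀ d, MemLp (fun w => X 0 w d) 2 P := fun d =>
    memLp_apply_of_hasLaw_multivariateGaussian (h.law_X 0) d (by simp)
  have hY := h.hasLaw_Y hGam hSig 0
  have hY2 : ∀ l, MemLp (fun w => Y 0 w l) 2 P := fun l =>
    memLp_apply_of_hasLaw_multivariateGaussian hY l (by simp)
  have h1 : ∀ᵐ w ∂P, ∀ d l, Tendsto
      (fun N : ℕ => (N : ℝ)⁻¹ * ∑ i ∈ Finset.range N, X i w d * Y i w l) atTop
      (𝓝 ((A * Gam) d l)) := by
    refine ae_all_iff.2 fun d => ae_all_iff.2 fun l => ?_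
    rw [← h.integral_X_mul_Y hGam hSig 0]
    exact h.ae_tendsto_mean (φ := fun p => p.1 d * p.2 l) (by fun_prop)
      ((hX2 d).integrable_mul (hY2 l))
  have h2 : ∀ᵐ w ∂P, ∀ l m, Tendsto
      (fun N : ℕ => (N : ℝ)⁻¹ * ∑ i ∈ Finset.range N, Y i w l * Y i w m) atTop
      (𝓝 (Gam l m)) := by
    refine ae_all_iff.2 fun l => ae_all_iff.2 fun m => ?_
    rw [← integral_mul_of_hasLaw_multivariateGaussian hY hGam.posSemidef]
    exact h.ae_tendsto_mean (φ := fun p => p.2 l * p.2 m) (by fun_prop)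
      ((hY2 l).integrable_mul (hY2 m))
  filter_upwards [h1, h2] with w hw1 hw2
  have hU : Tendsto (fun N : ℕ => Matrix.of fun d l =>
      (N : ℝ)⁻¹ * ∑ i ∈ Finset.range N, X i w d * Y i w l) atTop (𝓝 (A * Gam)) :=
    tendsto_pi_nhds.2 fun d => tendsto_pi_nhds.2 fun l => hw1 d l
  have hV : Tendsto (fun N : ℕ => Matrix.of fun l m =>
      (N : ℝ)⁻¹ * ∑ i ∈ Finset.range N, Y i w l * Y i w m) atTop (𝓝 Gam) :=
    tendsto_pi_nhds.2 fun l => tendsto_pi_nhds.2 fun m => hw2 l m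
  have hV' := (continuousAt_inv_of_isUnit_det hGam.det_pos.ne').tendsto.comp hV
  have hlim : Tendsto (fun N : ℕ =>
      (Matrix.of fun d l => (N : ℝ)⁻¹ * ∑ i ∈ Finset.range N, X i w d * Y i w l) *
      (Matrix.of fun l m => (N : ℝ)⁻¹ * ∑ i ∈ Finset.range N, Y i w l * Y i w m)⁻¹) atTop
      (𝓝 (A * Gam * Gam⁻¹)) :=
    ((continuous_fst.matrix_mul continuous_snd).tendsto (A * Gam, Gam⁻¹)).comp
      (hU.prodMk_nhds hV')
  rw [Matrix.mul_assoc, Matrix.mul_nonsing_inv _ hGam.det_pos.ne'.isUnit, Matrix.mul_one] at hlim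
  refine hlim.congr' ?_
  filter_upwards [eventually_gt_atTop 0] with N hN
  rw [aHat_eq_mean_mul_inv X Y hN]

theorem continuousAt_aStar (hGam : Gam.PosDef) (hSig : Sig.PosDef) :
    ContinuousAt (aStar Gam Sig) A := by
  have hg : aStar Gam Sig = fun B : Matrix (Fin D) (Fin L) ℝ =>
      (Gam⁻¹ + Bᵀ * Sig⁻¹ * B)⁻¹ * (Bᵀ * Sig⁻¹) := by
    funext B
    rw [aStar, Matrix.mul_assoc]
  have h0 : Continuous fun B : Matrix (Fin D) (Fin L) ℝ => Gam⁻¹ + Bᵀ * Sig⁻¹ * B := by fun_prop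
  have h1 : Tendsto (fun B : Matrix (Fin D) (Fin L) ℝ => (Gam⁻¹ + Bᵀ * Sig⁻¹ * B)⁻¹) (𝓝 A)
      (𝓝 (Gam⁻¹ + Aᵀ * Sig⁻¹ * A)⁻¹) :=
    (continuousAt_inv_of_isUnit_det (posDef_precision hGam hSig).det_pos.ne').tendsto.comp
      (h0.tendsto A)
  have h2 : Continuous fun B : Matrix (Fin D) (Fin L) ℝ => Bᵀ * Sig⁻¹ := by fun_prop
  have h3 : Continuous fun p : Matrix (Fin L) (Fin L) ℝ × Matrix (Fin L) (Fin D) ℝ =>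
      p.1 * p.2 := continuous_fst.matrix_mul continuous_snd
  have h4 := (h3.tendsto ((Gam⁻¹ + Aᵀ * Sig⁻¹ * A)⁻¹, Aᵀ * Sig⁻¹)).comp
    (h1.prodMk_nhds (h2.tendsto A))
  rw [hg]
  exact h4

/-- The covariance matrix of the linearized error tends to zero. -/
theorem IsForwardModel.tendsto_omega
    (h : IsForwardModel P (gamStar Gam A Sig) (aStar Gam Sig A) (sigStar Gam A Sig) X Y)
    (hL : 1 ≤ L) (hGam : Gam.PosDef) (hSig : Sig.PosDef) (x : Fin D → ℝ) :
    Tendsto (fun N => omega P Gam A Sig X Y N x) atTop (𝓝 0) := by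
  obtain ⟨K, hK, hν⟩ := hasNegMomentBound_multivariateGaussian hGam (s := 1 / 2) (by norm_num)
    (by norm_num)
  have hlaw : ∀ i, P.map (Y i) = (multivariateGaussian 0 Gam).map WithLp.ofLp := fun i =>
    map_eq_of_hasLaw_multivariateGaussian (h.hasLaw_Y hGam hSig i) (h.measurable_Y i)
  have hmom : ∀ j, ∀ p : ℝ≥0∞, p ≠ ∞ → MemLp (fun y : Fin L → ℝ => y j) p
      ((multivariateGaussian 0 Gam).map WithLp.ofLp) := fun j p hp => by
    rw [← hlaw 0, memLp_map_measure_iff (measurable_pi_apply j).aestronglyMeasurable (h.measurable_Y 0).aemeasurable]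
    exact memLp_apply_of_hasLaw_multivariateGaussian (h.hasLaw_Y hGam hSig 0) j hp
  -- Eighth moments of `x` control the fourth power of its mean squares; the sum over `d` is one
  -- bound for all coordinates.
  set M : ℝ≥0∞ := ∑ d, ∫⁻ w, ‖X 0 w d‖ₑ ^ 8 ∂P with hM
  have hMtop : M ≠ ∞ := by
    refine ENNReal.sum_ne_top.2 fun d _ => ?_
    have h8 := memLp_apply_of_hasLaw_multivariateGaussian (h.law_X 0) d (p := 8) (by simp)
    have := lintegral_rpow_enorm_lt_top_of_eLpNorm_lt_top (by simp) (by simp) h8.2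
    simpa using this.ne
  have hXM : ∀ i d, ∫⁻ w, ‖X i w d‖ₑ ^ 8 ∂P ≤ M := fun i d => by
    have hid := (h.identDistrib i 0).comp
      (u := fun p : (Fin D → ℝ) × (Fin L → ℝ) => ‖p.1 d‖ₑ ^ 8) (by fun_prop)
    have := hid.lintegral_eq
    simp only [Function.comp_def] at this
    rw [this]
    exact Finset.single_le_sum (f := fun d => ∫⁻ w, ‖X 0 w d‖ₑ ^ 8 ∂P) (fun _ _ => zero_le)
      (Finset.mem_univ d)
  obtain ⟨C, hC, hbd⟩ := exists_lintegral_aHat_pow_le (P := P) hL h.measurable_X h.measurable_Y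
    (h.indep.comp (fun _ p => p.2) fun _ => measurable_snd) hlaw hK hν hmom hMtop hXM
  refine InverseRegression.tendsto_omega (fun p q => tendsto_theta h.measurable_X h.measurable_Y ?_
    hC hbd p q) x
  filter_upwards [h.ae_tendsto_aHat hGam hSig] with w hw d l
  exact tendsto_pi_nhds.1 (tendsto_pi_nhds.1 hw d) l

end InverseRegression

/-! ### Quantiles of the chi-squared distribution -/

/-- At the infimum the left limit of the distribution function is at most `p`, and right continuity
makes its value at least `p`; without atoms the two agree. -/
theorem measureReal_Iic_sInf_eq {μ : Measure ℝ} [IsProbabilityMeasure μ] (hμ : ∀ t, μ {t} = 0)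
    {p : ℝ} (hp0 : 0 < p) (hp1 : p < 1) :
    μ.real (Set.Iic (sInf {t : ℝ | p ≤ μ.real (Set.Iic t)})) = p := by
  simp only [← cdf_eq_real]
  set S : Set ℝ := {t : ℝ | p ≤ cdf μ t} with hS
  set q := sInf S
  have hne : S.Nonempty := ((tendsto_cdf_atTop μ).eventually (lt_mem_nhds hp1)).exists.imp
    fun t ht => le_of_lt ht
  obtain ⟨t₀, ht₀⟩ := ((tendsto_cdf_atBot μ).eventually (gt_mem_nhds hp0)).exists
  have hbdd : BddBelow S := ⟨t₀, fun t ht => by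
    by_contra! hlt
    exact absurd (ht.trans ((cdf μ).mono hlt.le)) (not_le.2 ht₀)⟩
  apply le_antisymm
  · have hleft : Function.leftLim (cdf μ) q ≤ p := by
      refine le_of_tendsto ((cdf μ).mono.tendsto_leftLim q) ?_
      filter_upwards [self_mem_nhdsWithin] with x hx
      by_contra! hlt
      exact absurd (csInf_le hbdd (show x ∈ S from hlt.le)) (not_le.2 hx)
    have hsing := (cdf μ).measure_singleton q
    rw [measure_cdf, hμ, eq_comm, ENNReal.ofReal_eq_zero] at hsing
    linarith
  · refine ge_of_tendsto (((cdf μ).right_continuous q).mono Set.Ioi_subset_Ici_self) ?_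
    filter_upwards [self_mem_nhdsWithin] with x hx
    obtain ⟨t, ht, htx⟩ := exists_lt_of_csInf_lt hne hx
    exact ht.trans ((cdf μ).mono htx.le)

namespace InverseRegression

instance (k : ℕ) : IsProbabilityMeasure (chiSq k) :=
  Measure.isProbabilityMeasure_map
    (Measurable.aemeasurable (f := fun z : Fin k → ℝ => ∑ i, z i ^ 2) (by fun_prop))

/-- By Fubini: with the other coordinates fixed, at most two values of the first one give the sum
`t`. For `k = 0` the law is a point mass. -/
theorem chiSq_singleton {k : ℕ} (hk : 1 ≤ k) (t : ℝ) : chiSq k {t} = 0 := by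
  obtain ⟨k, rfl⟩ := Nat.exists_eq_add_of_le' hk
  have hm : Measurable fun z : Fin (k + 1) → ℝ => ∑ i, z i ^ 2 := by fun_prop
  have hs : MeasurableSet ((fun z : Fin (k + 1) → ℝ => ∑ i, z i ^ 2) ⁻¹' {t}) :=
    hm (measurableSet_singleton t)
  rw [chiSq, Measure.map_apply hm (measurableSet_singleton t)]
  have hmp := (measurePreserving_piFinSuccAbove (fun _ : Fin (k + 1) => gaussianReal 0 1) 0).symm
  rw [← hmp.measure_preimage hs.nullMeasurableSet]
  refine (Measure.prod_apply_symm (hmp.measurable hs)).trans ?_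
  refine (lintegral_congr fun z => ?_).trans lintegral_zero
  have hfin : ({√(t - ∑ i, z i ^ 2), -√(t - ∑ i, z i ^ 2)} : Set ℝ).Finite := Set.toFinite _
  have := nullSingletonClass_gaussianReal (μ := 0) (v := 1) one_ne_zero
  refine (hfin.subset fun u hu => ?_).measure_zero _
  have hu' : u ^ 2 + ∑ i, z i ^ 2 = t := by
    simpa [MeasurableEquiv.piFinSuccAbove, Fin.insertNthEquiv, Fin.sum_univ_succ] using hu
  have h : t - ∑ i, z i ^ 2 = u ^ 2 := by linarith
  rw [h, Real.sqrt_sq_eq_abs]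
  rcases abs_choice u with h | h <;> simp [h]

theorem chiSq_Iic_chiSqQuantile {k : ℕ} (hk : 1 ≤ k) {p : ℝ} (hp0 : 0 < p) (hp1 : p < 1) :
    (chiSq k).real (Set.Iic (chiSqQuantile k p)) = p :=
  measureReal_Iic_sInf_eq (chiSq_singleton hk) hp0 hp1

-- Write `e = R z` with `R` the symmetric square root of `S` and `z` standard normal; then `R S⁻¹ R
-- = 1` turns the form into `‖z‖²`.
open scoped MatrixOrder in
theorem map_quadraticForm_multivariateGaussian {k : ℕ} {S : Matrix (Fin k) (Fin k) ℝ}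
    (hS : S.PosDef) :
    ((multivariateGaussian 0 S).map (WithLp.ofLp : _ → Fin k → ℝ)).map
      (fun e => e ⬝ᵥ S⁻¹ *ᵥ e) = chiSq k := by
  have hq : Measurable fun e : Fin k → ℝ => e ⬝ᵥ S⁻¹ *ᵥ e := by
    simp only [dotProduct, Matrix.mulVec]
    fun_prop
  set R := CFC.sqrt S with hR
  have hRR : R * R = S := CFC.sqrt_mul_sqrt_self S hS.posSemidef.nonneg
  have hRT : Rᵀ = R := by
    have := (CFC.sqrt_nonneg S).isSelfAdjoint
    simpa [IsSelfAdjoint, Matrix.star_eq_conjTranspose] using this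
  have hdet : IsUnit R.det := by
    have h : R.det * R.det = S.det := by rw [← Matrix.det_mul, hRR]
    exact (left_ne_zero_of_mul (h.trans_ne hS.det_pos.ne')).isUnit
  have hRRinv : 1 = R * (S⁻¹ᵀ * R) := by
    rw [Matrix.transpose_nonsing_inv, transpose_eq_of_posDef hS, ← hRR, Matrix.mul_inv_rev,
      Matrix.mul_assoc, Matrix.nonsing_inv_mul _ hdet, Matrix.mul_one,
      Matrix.mul_nonsing_inv _ hdet]
  have hz : ∀ z : Fin k → ℝ, WithLp.ofLp ((0 : EuclideanSpace ℝ (Fin k)) +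
      Matrix.toEuclideanCLM (𝕜 := ℝ) R (WithLp.toLp 2 z)) = R *ᵥ z := fun z => by
    rw [zero_add]
    simp
  have hpush : (multivariateGaussian 0 S).map (WithLp.ofLp : _ → Fin k → ℝ)
      = (Measure.pi fun _ : Fin k => gaussianReal 0 1).map fun z => R *ᵥ z := by
    rw [multivariateGaussian, ← map_pi_eq_stdGaussian, Measure.map_map (by fun_prop) (by fun_prop),
      Measure.map_map (by fun_prop) (by fun_prop)]
    exact congrArg (fun f => Measure.map f _) (funext hz)
  have hRm : Measurable fun z : Fin k → ℝ => R *ᵥ z := measurable_mulVec measurable_id R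
  rw [hpush, Measure.map_map hq hRm, chiSq]
  congr 1
  funext z
  rw [Function.comp_apply, Matrix.dotProduct_mulVec, Matrix.dotProduct_mulVec,
    ← Matrix.mulVec_transpose, ← Matrix.mulVec_transpose, hRT, Matrix.mulVec_mulVec,
    Matrix.mulVec_mulVec, Matrix.mul_assoc, ← hRRinv, Matrix.one_mulVec]
  simp [dotProduct, sq]

theorem measurable_quadraticForm {α : Type*} [MeasurableSpace α] {k : ℕ} {v : α → Fin k → ℝ}
    {M : α → Matrix (Fin k) (Fin k) ℝ} (hv : ∀ i, Measurable fun a => v a i)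
    (hM : ∀ i j, Measurable fun a => M a i j) : Measurable fun a => v a ⬝ᵥ M a *ᵥ v a := by
  simp only [dotProduct, Matrix.mulVec]
  fun_prop

theorem tendsto_quadraticForm {ι : Type*} {l : Filter ι} {k : ℕ} {v : ι → Fin k → ℝ}
    {M : ι → Matrix (Fin k) (Fin k) ℝ} {v₀ : Fin k → ℝ} {M₀ : Matrix (Fin k) (Fin k) ℝ}
    (hv : Tendsto v l (𝓝 v₀)) (hM : Tendsto M l (𝓝 M₀)) :
    Tendsto (fun i => v i ⬝ᵥ M i *ᵥ v i) l (𝓝 (v₀ ⬝ᵥ M₀ *ᵥ v₀)) := by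
  have hc : Continuous fun p : (Fin k → ℝ) × Matrix (Fin k) (Fin k) ℝ => p.1 ⬝ᵥ p.2 *ᵥ p.1 := by
    fun_prop
  exact (hc.tendsto (v₀, M₀)).comp (hv.prodMk_nhds hM)

/-- Off the null event `Q₀ = q`, the indicators of `Q n ≤ q` are eventually constant, so their
integrals converge. -/
theorem tendsto_measureReal_le {Ω : Type*} [MeasurableSpace Ω] {μ : Measure Ω}
    [IsProbabilityMeasure μ] {Q : ℕ → Ω → ℝ} {Q₀ : Ω → ℝ} (hQ : ∀ n, Measurable (Q n))
    (hQ₀ : Measurable Q₀) (hlim : ∀ᵐ r ∂μ, Tendsto (fun n => Q n r) atTop (𝓝 (Q₀ r))) {q : ℝ}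
    (hq : ∀ᵐ r ∂μ, Q₀ r ≠ q) :
    Tendsto (fun n => μ.real {r | Q n r ≤ q}) atTop (𝓝 (μ.real {r | Q₀ r ≤ q})) := by
  refine (ENNReal.tendsto_toReal (measure_ne_top _ _)).comp
    (tendsto_measure_of_ae_tendsto_indicator_of_isFiniteMeasure atTop
      (measurableSet_le hQ₀ measurable_const)
      (fun n => measurableSet_le (hQ n) measurable_const) ?_)
  filter_upwards [hlim, hq] with r hr hrq
  rcases lt_or_gt_of_ne hrq with hlt | hgt
  · filter_upwards [hr.eventually (gt_mem_nhds hlt)] with n hn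
    exact ⟨fun _ => hlt.le, fun _ => le_of_lt hn⟩
  · filter_upwards [hr.eventually (lt_mem_nhds hgt)] with n hn
    exact ⟨fun h' => absurd h' (not_le.2 hn), fun h' => absurd h' (not_le.2 hgt)⟩

/-! ### Asymptotic coverage -/

variable {L D : ℕ} {Gam : Matrix (Fin L) (Fin L) ℝ} {A : Matrix (Fin D) (Fin L) ℝ}
  {Sig : Matrix (Fin D) (Fin D) ℝ} {W : Type*} [MeasurableSpace W]

theorem measurable_aStarHat_apply {X : ℕ → W → Fin D → ℝ} {Y : ℕ → W → Fin L → ℝ}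
    (hX : ∀ i, Measurable (X i)) (hY : ∀ i, Measurable (Y i)) (N : ℕ) (l : Fin L) (d : Fin D) :
    Measurable fun w => aStarHat Gam Sig X Y N w l d := by
  have h := measurable_aHat_apply hX hY N
  have hT : ∀ l d, Measurable fun w => (aHat X Y N w)ᵀ l d := fun l d => h d l
  have hc : ∀ i j, Measurable fun _ : W => Sig⁻¹ i j := fun _ _ => measurable_const
  have h1 := measurable_mul_apply (measurable_mul_apply hT hc) h
  have h2 : ∀ i j, Measurable fun w =>
      (Gam⁻¹ + (aHat X Y N w)ᵀ * Sig⁻¹ * aHat X Y N w) i j := fun i j => (h1 i j).const_add _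
  exact measurable_mul_apply (measurable_mul_apply (measurable_inv_apply h2) hT) hc l d

theorem measurable_omega_apply (P : Measure W) (X : ℕ → W → Fin D → ℝ) (Y : ℕ → W → Fin L → ℝ)
    (N : ℕ) (i j : Fin L) : Measurable fun x => omega P Gam A Sig X Y N x i j := by
  have h : ∀ l p, Measurable fun x : Fin D → ℝ => rowKron L x l p := fun l p => by
    simp only [rowKron, Matrix.submatrix_apply, Matrix.kroneckerMap_apply,
      Matrix.replicateRow_apply, id]
    fun_prop
  have hc : ∀ p q, Measurable fun _ : Fin D → ℝ => theta P Gam A Sig X Y N p q :=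
    fun _ _ => measurable_const
  have hT : ∀ p l, Measurable fun x : Fin D → ℝ => (rowKron L x)ᵀ p l := fun p l => h l p
  exact measurable_mul_apply (measurable_mul_apply h hc) hT i j

theorem IsForwardModel.indepFun_aStarHat {P : Measure W} {GamS : Matrix (Fin D) (Fin D) ℝ}
    {AS : Matrix (Fin L) (Fin D) ℝ} {SigS : Matrix (Fin L) (Fin L) ℝ} {X : ℕ → W → Fin D → ℝ}
    {Y : ℕ → W → Fin L → ℝ} (h : IsForwardModel P GamS AS SigS X Y) (N : ℕ) :
    IndepFun (fun w l d => aStarHat Gam Sig X Y N w l d)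
      (fun w => (X N w, Y N w - AS *ᵥ X N w)) P := by
  have hpair : ∀ i, Measurable fun w => (X i w, Y i w) := fun i =>
    (h.measurable_X i).prodMk (h.measurable_Y i)
  have h1 := h.indep.indepFun_finset (Finset.range N) {N} (by simp) hpair
  -- The estimator is rewritten as a function of the first `N` pairs alone; the value `0` outside
  -- the range is never read by `dataMatrix N`.
  set X' : ℕ → (Finset.range N → (Fin D → ℝ) × (Fin L → ℝ)) → Fin D → ℝ :=
    fun i z => if hi : i ∈ Finset.range N then (z ⟨i, hi⟩).1 else 0 with hX'
  set Y' : ℕ → (Finset.range N → (Fin D → ℝ) × (Fin L → ℝ)) → Fin L → ℝ :=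
    fun i z => if hi : i ∈ Finset.range N then (z ⟨i, hi⟩).2 else 0 with hY'
  have hX'm : ∀ i, Measurable (X' i) := fun i => by
    by_cases hi : i ∈ Finset.range N
    · simp only [hX', hi, dif_pos]; fun_prop
    · simp only [hX', hi]; exact measurable_const
  have hY'm : ∀ i, Measurable (Y' i) := fun i => by
    by_cases hi : i ∈ Finset.range N
    · simp only [hY', hi, dif_pos]; fun_prop
    · simp only [hY', hi]; exact measurable_const
  have hAS := measurable_mulVec (measurable_fst (α := Fin D → ℝ) (β := Fin L → ℝ)) AS
  have h2 := h1.comp (φ := fun z l d => aStarHat Gam Sig X' Y' N z l d)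
    (ψ := fun z : ({N} : Finset ℕ) → (Fin D → ℝ) × (Fin L → ℝ) =>
      ((z ⟨N, by simp⟩).1, (z ⟨N, by simp⟩).2 - AS *ᵥ (z ⟨N, by simp⟩).1))
    (measurable_pi_lambda _ fun l => measurable_pi_lambda _ fun d =>
      measurable_aStarHat_apply hX'm hY'm N l d)
    (Measurable.comp (g := fun p : (Fin D → ℝ) × (Fin L → ℝ) => (p.1, p.2 - AS *ᵥ p.1))
      (by fun_prop) (measurable_pi_apply _))
  refine h2.congr (ae_of_all _ fun w => ?_) (ae_of_all _ fun w => rfl)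
  funext l d
  have eX : dataMatrix N X w = dataMatrix N X' fun i => (X i w, Y i w) := by
    ext i j
    simp [dataMatrix, hX']
  have eY : dataMatrix N Y w = dataMatrix N Y' fun i => (X i w, Y i w) := by
    ext i j
    simp [dataMatrix, hY']
  simp only [Function.comp_apply, aStarHat, aHat, eX, eY]

/-- Coverage of the prediction region at the covariate `g x`, where `x` is a new covariate. -/
theorem IsForwardModel.tendsto_coverage {P : Measure W} [IsProbabilityMeasure P]
    {X : ℕ → W → Fin D → ℝ} {Y : ℕ → W → Fin L → ℝ}
    (h : IsForwardModel P (gamStar Gam A Sig) (aStar Gam Sig A) (sigStar Gam A Sig) X Y)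
    (hL : 1 ≤ L) (hGam : Gam.PosDef) (hSig : Sig.PosDef) {α : ℝ} (hα0 : 0 < α) (hα1 : α < 1)
    {g : (Fin D → ℝ) → Fin D → ℝ} (hg : Measurable g) :
    Tendsto (fun N : ℕ => P.real {w | aStar Gam Sig A *ᵥ g (X N w) +
        (Y N w - aStar Gam Sig A *ᵥ X N w) ∈
        predictionRegion P Gam A Sig X Y α N w (g (X N w))}) atTop (𝓝 (1 - α)) := by
  set AS := aStar Gam Sig A with hAS
  set SS := sigStar Gam A Sig with hSS
  have hSSpd : SS.PosDef := posDef_sigStar hGam hSig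
  set q := chiSqQuantile L (1 - α) with hq
  set μe : Measure (Fin L → ℝ) := (multivariateGaussian 0 SS).map WithLp.ofLp with hμe
  set μX : Measure (Fin D → ℝ) :=
    (multivariateGaussian 0 (gamStar Gam A Sig)).map WithLp.ofLp with hμX
  have : IsProbabilityMeasure μe := Measure.isProbabilityMeasure_map (by fun_prop)
  have : IsProbabilityMeasure μX := Measure.isProbabilityMeasure_map (by fun_prop)
  set res : (Fin L → Fin D → ℝ) × (Fin D → ℝ) × (Fin L → ℝ) → Fin L → ℝ :=
    fun r => AS *ᵥ g r.2.1 + r.2.2 - Matrix.of r.1 *ᵥ g r.2.1 with hres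
  set Q : ℕ → (Fin L → Fin D → ℝ) × (Fin D → ℝ) × (Fin L → ℝ) → ℝ := fun N r =>
    res r ⬝ᵥ (omega P Gam A Sig X Y N (g r.2.1) + SS)⁻¹ *ᵥ res r with hQ
  set Q₀ : (Fin L → ℝ) → ℝ := fun e => e ⬝ᵥ SS⁻¹ *ᵥ e with hQ₀
  have hgm : ∀ d, Measurable fun r : (Fin L → Fin D → ℝ) × (Fin D → ℝ) × (Fin L → ℝ) =>
      g r.2.1 d := fun d => by fun_prop
  have hresm : ∀ l, Measurable fun r => res r l := fun l => by
    simp only [hres, Pi.add_apply, Pi.sub_apply, Matrix.mulVec, dotProduct, Matrix.of_apply]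
    fun_prop
  have hQm : ∀ N, Measurable (Q N) := fun N => by
    have hinv : ∀ i j, Measurable fun r : (Fin L → Fin D → ℝ) × (Fin D → ℝ) × (Fin L → ℝ) =>
        (omega P Gam A Sig X Y N (g r.2.1) + SS)⁻¹ i j := fun i j => by
      refine measurable_inv_apply (fun i j => ?_) i j
      simp only [Matrix.add_apply]
      exact ((measurable_omega_apply P X Y N i j).comp (by fun_prop)).add_const _
    exact measurable_quadraticForm hresm hinv
  have hQ₀m : Measurable Q₀ :=
    measurable_quadraticForm measurable_pi_apply fun _ _ => measurable_const
  set ah : ℕ → W → Fin L → Fin D → ℝ := fun N w l d => aStarHat Gam Sig X Y N w l d with hah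
  have hahm : ∀ N, Measurable (ah N) := fun N => measurable_pi_lambda _ fun l =>
    measurable_pi_lambda _ fun d => measurable_aStarHat_apply h.measurable_X h.measurable_Y N l d
  have hpm : ∀ N, Measurable fun w => (X N w, Y N w - AS *ᵥ X N w) := fun N => by
    have hXm := h.measurable_X N
    have hYm := h.measurable_Y N
    have hBX := measurable_mulVec hXm AS
    fun_prop
  -- The new pair is independent of the estimator and its law does not depend on `N`. On the product
  -- space it can therefore be held fixed while `N → ∞`.
  have hjoint : ∀ N, P.map (fun w => (ah N w, (X N w, Y N w - AS *ᵥ X N w)))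
      = (P.prod (μX.prod μe)).map (Prod.map (ah N) id) := fun N => by
    rw [(indepFun_iff_map_prod_eq_prod_map_map (hahm N).aemeasurable (hpm N).aemeasurable).1
      (h.indepFun_aStarHat N), h.map_pair, ← Measure.map_prod_map _ _ (hahm N) measurable_id,
      Measure.map_id]
  have hprob : ∀ N, P.real {w | AS *ᵥ g (X N w) + (Y N w - AS *ᵥ X N w) ∈
        predictionRegion P Gam A Sig X Y α N w (g (X N w))}
      = (P.prod (μX.prod μe)).real {r | Q N (ah N r.1, r.2) ≤ q} := fun N => by
    have hE : MeasurableSet {r | Q N r ≤ q} := measurableSet_le (hQm N) measurable_const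
    have h1 : P.map (fun w => (ah N w, (X N w, Y N w - AS *ᵥ X N w))) {r | Q N r ≤ q}
        = (P.prod (μX.prod μe)).map (Prod.map (ah N) id) {r | Q N r ≤ q} := by rw [hjoint N]
    rw [Measure.map_apply ((hahm N).prodMk (hpm N)) hE,
      Measure.map_apply ((hahm N).prodMap measurable_id) hE] at h1
    exact congrArg ENNReal.toReal h1
  have hlim : (P.prod (μX.prod μe)).real {r | Q₀ r.2.2 ≤ q} = 1 - α := by
    have hE : MeasurableSet {e | Q₀ e ≤ q} := measurableSet_le hQ₀m measurable_const
    have e1 : {r : W × (Fin D → ℝ) × (Fin L → ℝ) | Q₀ r.2.2 ≤ q}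
        = Set.univ ×ˢ (Set.univ ×ˢ {e | Q₀ e ≤ q}) := by ext; simp
    rw [e1, measureReal_def, Measure.prod_prod, Measure.prod_prod, measure_univ, measure_univ,
      one_mul, one_mul]
    have h1 := chiSq_Iic_chiSqQuantile hL (p := 1 - α) (by linarith) (by linarith)
    rw [← map_quadraticForm_multivariateGaussian hSSpd, measureReal_def,
      Measure.map_apply hQ₀m measurableSet_Iic] at h1
    exact h1
  -- The limiting form almost surely misses the boundary of the region, since `χ²_L` has no atoms.
  have hbdry : ∀ᵐ e ∂μe, Q₀ e ≠ q := by
    have h1 := chiSq_singleton hL q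
    rw [← map_quadraticForm_multivariateGaussian hSSpd,
      Measure.map_apply hQ₀m (measurableSet_singleton q)] at h1
    simp only [ae_iff, ne_eq, not_not]
    exact h1
  have hae : ∀ᵐ r ∂(P.prod (μX.prod μe)),
      Tendsto (fun N => Q N (ah N r.1, r.2)) atTop (𝓝 (Q₀ r.2.2)) := by
    have h1 : ∀ᵐ r ∂(P.prod (μX.prod μe)), Tendsto (fun N => aHat X Y N r.1) atTop (𝓝 A) :=
      Measure.quasiMeasurePreserving_fst.ae (h.ae_tendsto_aHat hGam hSig)
    filter_upwards [h1] with r hr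
    have h2 : Tendsto (fun N => aStarHat Gam Sig X Y N r.1) atTop (𝓝 AS) :=
      (continuousAt_aStar hGam hSig).tendsto.comp hr
    have hcont : Continuous fun B : Matrix (Fin L) (Fin D) ℝ =>
        AS *ᵥ g r.2.1 + r.2.2 - B *ᵥ g r.2.1 := by fun_prop
    have h3 : Tendsto (fun N => res (ah N r.1, r.2)) atTop (𝓝 r.2.2) := by
      have h4 : Tendsto (fun N => res (ah N r.1, r.2)) atTop
          (𝓝 (AS *ᵥ g r.2.1 + r.2.2 - AS *ᵥ g r.2.1)) := (hcont.tendsto AS).comp h2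
      rwa [add_sub_cancel_left] at h4
    -- The limit `Ω → 0` is needed only pointwise in the covariate, because the new pair is fixed
    -- here.
    have h5 : Tendsto (fun N => (omega P Gam A Sig X Y N (g r.2.1) + SS)⁻¹) atTop (𝓝 SS⁻¹) := by
      have h6 := (h.tendsto_omega hL hGam hSig (g r.2.1)).add_const SS
      rw [zero_add] at h6
      exact (continuousAt_inv_of_isUnit_det hSSpd.det_pos.ne').tendsto.comp h6
    exact tendsto_quadraticForm h3 h5
  have hbdry' : ∀ᵐ r ∂(P.prod (μX.prod μe)), Q₀ r.2.2 ≠ q :=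
    Measure.quasiMeasurePreserving_snd.ae (Measure.quasiMeasurePreserving_snd.ae hbdry)
  rw [← hlim]
  refine (tendsto_measureReal_le (fun N => ?_) ?_ hae hbdry').congr fun N => (hprob N).symm
  · exact (hQm N).comp (((hahm N).comp measurable_fst).prodMk measurable_snd)
  · exact hQ₀m.comp (measurable_snd.comp measurable_snd)

end InverseRegression

theorem mainTheorem2 {W : Type*} [MeasurableSpace W] (P : Measure W) [IsProbabilityMeasure P]
    (L D : ℕ) (hL : 1 ≤ L)
    (Gam : Matrix (Fin L) (Fin L) ℝ) (hGam : Gam.PosDef)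
    (A : Matrix (Fin D) (Fin L) ℝ)
    (Sig : Matrix (Fin D) (Fin D) ℝ) (hSig : Sig.PosDef) (hSig_diag : Sig.IsDiag)
    (X : ℕ → W → Fin D → ℝ) (Y : ℕ → W → Fin L → ℝ)
    (hmodel : InverseRegression.IsForwardModel P (InverseRegression.gamStar Gam A Sig)
      (InverseRegression.aStar Gam Sig A) (InverseRegression.sigStar Gam A Sig) X Y)
    (α : ℝ) (hα0 : 0 < α) (hα1 : α < 1) :
    -- random new pair `(x_{N+1}, y_{N+1})` drawn from the model, independently of the sample
    Tendsto (fun N : ℕ => P.real {w | Y N w ∈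
        InverseRegression.predictionRegion P Gam A Sig X Y α N w (X N w)})
      atTop (𝓝 (1 - α)) ∧
    -- given new covariate `x`, with response `y = A⋆ x + ε_{N+1}`
    ∀ x : Fin D → ℝ,
      Tendsto (fun N : ℕ => P.real {w |
          InverseRegression.aStar Gam Sig A *ᵥ x +
            (Y N w - InverseRegression.aStar Gam Sig A *ᵥ X N w) ∈
          InverseRegression.predictionRegion P Gam A Sig X Y α N w x})
        atTop (𝓝 (1 - α)) := by
  -- Both claims are one coverage statement: a constant `g` freezes the covariate, and `g = id`
  -- recovers `y = A⋆ x + (y - A⋆ x)`.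
  refine ⟨?_, fun x => hmodel.tendsto_coverage hL hGam hSig hα0 hα1 (g := fun _ => x)
    measurable_const⟩
  simpa only [id, add_sub_cancel] using
    hmodel.tendsto_coverage hL hGam hSig hα0 hα1 (g := id) measurable_id
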